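/- Let $X$ be an infinite-dimensional complex Banach space. For an operator $A$ in $X$ with domain $\mathcal D(A)$ let $\mathcal D(A^n)=\{x: x,Ax,\dots,A^{n-1}x\in\mathcal D(A)\}$, let $\rho(A)$ be the set of $\lambda\in\mathbb C$ for which $\lambda-A:\mathcal D(A)\to X$ is bijective, $\sigma(A)=\mathbb C\setminus\rho(A)$ and $\sigma_\infty(A)=\sigma(A)\cup\{\infty\}\subset\mathbb C\cup\{\infty\}$. $A$ is Fredholm if its range is closed and of finite codimension and its null space is finite-dimensional, and Browder if moreover its ascent and descent are finite; $\sigma_e(A)$ (resp. $\sigma_b(A)$) is the set of $\lambda$ for which $A-\lambda$ is not Fredholm (resp. not Browder), and the points of $\sigma(A)\setminus\sigma_b(A)$ are the Riesz points of $A$. A bounded operator $T$ on $X$ is Riesz if $\sigma_e(T)=\{0\}$. A bounded set $\sigma\subset\sigma(A)$ is a bounded spectral set of $A$ if it is open and closed in $\sigma_\infty(A)$; its spectral projection $P_\sigma$ is the bounded projection with null space $M$ and range $N\subset\mathcal D(A)$, both invariant under $A$, such that the parts of $A$ in $M$ and $N$ satisfy $\sigma(A_M)=\sigma(A)\setminus\sigma$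 and $\sigma(A_N)=\sigma$. The Drazin inverse of $A$ related to $\sigma\ni 0$ is $A^{D,\sigma}=(A-\xi P_\sigma)^{-1}(I-P_\sigma)$ for some $\xi\in\mathbb C$ with $|\xi|>2\sup_{\lambda\in\sigma}|\lambda|$. A bounded operator $B$ is a generalized Drazin–Riesz inverse of $A$ if the ranges of $B$ and $I-AB$ lie in $\mathcal D(A)$, $BAB=B$, $BAx=ABx$ for $x\in\mathcal D(A)$, and $A(I-AB)$ is bounded and Riesz. Let $A$ be a closed densely defined operator in $X$ with $\sigma_e(A)\ne\mathbb C$ and $\mathcal D(A^{j+1})=\mathcal D(A^j)$ for all sufficiently large $j$, and suppose that $0$ is an isolated point of $\sigma_b(A)$. Call a bounded spectral set $\sigma$ of $A$ suitable if $0\in\sigma$, every point of $\sigma\setminus\{0\}$ is a Riesz point of $A$, and for some $r_0<\frac14$ one has $\sigma\subset D(0,r_0)$ and $(D(0,r_0)\setminus\{0\})\cap(\sigma(A)\setminus\sigma)=\emptyset$, where $D(0,r_0)=\{z\in\mathbb C:|z|<r_0\}$. Then suitable sets exist. For every suitable $\sigma$, the operators $P_\sigma$ and $A^{D,\sigma}$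 exist, $A^{D,\sigma}$ is a generalized Drazin–Riesz inverse of $A$, the operators $AP_\sigma$, $AA^{D,\sigma}$ and $A^{p}(I-AA^{D,\sigma})$, $p\ge 0$, are everywhere defined and bounded, and for every $\lambda\in\mathbb C$ with $r(AP_\sigma)<|\lambda|<r(A^{D,\sigma})^{-1}$, where $r$ is the spectral radius and $0^{-1}=\infty$, one has $\lambda\in\rho(A)$ and $$(\lambda-A)^{-1}=\sum_{p=1}^{\infty}\lambda^{-p}A^{p-1}(I-AA^{D,\sigma})-\sum_{p=0}^{\infty}\lambda^{p}(A^{D,\sigma})^{p+1},$$ both series converging unconditionally in the operator norm. -/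

import Mathlib

open Topology Filter

noncomputable section

namespace ClosedOp

section Algebraic

variable {E : Type*} [AddCommGroup E] [Module ℂ E]

/-- A linear map regarded as an everywhere defined operator. -/
def ofLinear (T : E →ₗ[ℂ] E) : E →ₗ.[ℂ] E := T.toPMap ⊤

/-- The product `g f`, with its natural domain `{x ∈ D(f) : f x ∈ D(g)}`. -/
def pcomp (g f : E →ₗ.[ℂ] E) : E →ₗ.[ℂ] E :=
  g.comp (f.domRestrict ((g.domain.comap f.toFun).map f.domain.subtype)) (by
    rintro ⟨x, hx, hxf⟩
    obtain ⟨y, hy, rfl⟩ := hx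
    exact hy)

/-- The powers of an operator; `D(Aⁿ) = {x : x, A x, …, Aⁿ⁻¹ x ∈ D(A)}` and `A⁰ = I`. -/
def pow (A : E →ₗ.[ℂ] E) : ℕ → (E →ₗ.[ℂ] E)
  | 0 => ofLinear LinearMap.id
  | n + 1 => pcomp A (pow A n)

/-- The operator `z - A`, with domain `D(A)`. -/
def scalarSub (z : ℂ) (A : E →ₗ.[ℂ] E) : E →ₗ.[ℂ] E :=
  (z • (LinearMap.id : E →ₗ[ℂ] E)) +ᵥ (-A)

/-- The operator `A - T`, with domain `D(A)`, for an everywhere defined `T`. -/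
def subLinear (A : E →ₗ.[ℂ] E) (T : E →ₗ[ℂ] E) : E →ₗ.[ℂ] E := (-T) +ᵥ A

/-- The null space, as a subspace of the whole space. -/
def nullSpace (A : E →ₗ.[ℂ] E) : Submodule ℂ E :=
  (LinearMap.ker A.toFun).map A.domain.subtype

/-- The range. -/
def rangeSpace (A : E →ₗ.[ℂ] E) : Submodule ℂ E := LinearMap.range A.toFun

/-- The resolvent set `{z : z - A is bijective from D(A) onto the space}`. -/
def resolventSet (A : E →ₗ.[ℂ] E) : Set ℂ :=
  {z | Function.Bijective (scalarSub z A)}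

/-- The spectrum. -/
def spec (A : E →ₗ.[ℂ] E) : Set ℂ := (resolventSet A)ᶜ

/-- The compactified spectrum `σ(A) ∪ {∞}` in the Riemann sphere. -/
def specInfty (A : E →ₗ.[ℂ] E) : Set (OnePoint ℂ) :=
  ((↑) : ℂ → OnePoint ℂ) '' spec A ∪ {OnePoint.infty}

/-- A spectral set: a clopen subset of the compactified spectrum. -/
def IsSpectralSet (A : E →ₗ.[ℂ] E) (s : Set (OnePoint ℂ)) : Prop :=
  s ⊆ specInfty A ∧ IsClopen (Subtype.val ⁻¹' s : Set (specInfty A))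

/-- A bounded spectral set, given as a subset of the plane. -/
def IsBoundedSpectralSet (A : E →ₗ.[ℂ] E) (s : Set ℂ) : Prop :=
  Bornology.IsBounded s ∧ IsSpectralSet A (((↑) : ℂ → OnePoint ℂ) '' s)

/-- The part `A_M` of `A` in an invariant subspace `M`, with `D(A_M) = M ∩ D(A)`. -/
def part (A : E →ₗ.[ℂ] E) (M : Submodule ℂ E)
    (h : ∀ x : A.domain, (x : E) ∈ M → A x ∈ M) : M →ₗ.[ℂ] M where
  domain := A.domain.comap M.subtype
  toFun :=
    { toFun := fun x => ⟨A ⟨((x : M) : E), x.2⟩, h _ (x : M).2⟩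
      map_add' := fun x y => Subtype.ext (A.map_add ⟨_, x.2⟩ ⟨_, y.2⟩)
      map_smul' := fun c x => Subtype.ext (A.map_smul c ⟨_, x.2⟩) }

end Algebraic

variable {X : Type*} [NormedAddCommGroup X] [NormedSpace ℂ X]

/-- Fredholm operators: closed range, finite-dimensional null space, range of finite
codimension. -/
structure IsFredholm (A : X →ₗ.[ℂ] X) : Prop where
  isClosed_range : IsClosed (rangeSpace A : Set X)
  finite_nullSpace : FiniteDimensional ℂ (nullSpace A)
  finite_codim : FiniteDimensional ℂ (X ⧸ rangeSpace A)

/-- Browder operators: Fredholm operators of finite ascent and finite descent. -/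
structure IsBrowder (A : X →ₗ.[ℂ] X) : Prop where
  isFredholm : IsFredholm A
  finite_ascent : ∃ n : ℕ, nullSpace (pow A n) = nullSpace (pow A (n + 1))
  finite_descent : ∃ n : ℕ, rangeSpace (pow A n) = rangeSpace (pow A (n + 1))

/-- The essential spectrum. -/
def essSpec (A : X →ₗ.[ℂ] X) : Set ℂ :=
  {z | ¬ IsFredholm (subLinear A (z • LinearMap.id))}

/-- The Browder spectrum. -/
def browderSpec (A : X →ₗ.[ℂ] X) : Set ℂ :=
  {z | ¬ IsBrowder (subLinear A (z • LinearMap.id))}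

/-- The Riesz points `σ(A) \ σ_b(A)`. -/
def rieszPoints (A : X →ₗ.[ℂ] X) : Set ℂ := spec A \ browderSpec A

/-- Isolated points of a set of complex numbers. -/
def isoPts (K : Set ℂ) : Set ℂ := {z | z ∈ K ∧ ¬ AccPt z (𝓟 K)}

/-- Bounded Riesz operators. -/
def IsRiesz (T : X →L[ℂ] X) : Prop := essSpec (ofLinear (T : X →ₗ[ℂ] X)) = {0}

/-- The class `Ĉ(X)`: closed densely defined operators with non-empty essential resolvent set
for which `D(Aʲ⁺¹) = D(Aʲ)` for all sufficiently large `j`. -/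
structure MemChat (A : X →ₗ.[ℂ] X) : Prop where
  isClosed : A.IsClosed
  dense_domain : Dense (A.domain : Set X)
  essResolvent_nonempty : ((essSpec A)ᶜ).Nonempty
  domain_stabilizes : ∃ J : ℕ, ∀ j ≥ J, (pow A (j + 1)).domain = (pow A j).domain

/-- `(M, N) ∈ Red(A)`. -/
structure IsReduction (A : X →ₗ.[ℂ] X) (M N : Submodule ℂ X) : Prop where
  isClosed_left : IsClosed (M : Set X)
  isClosed_right : IsClosed (N : Set X)
  map_left : ∀ x : A.domain, (x : X) ∈ M → A x ∈ M
  right_le_domain : N ≤ A.domain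
  map_right : ∀ x : A.domain, (x : X) ∈ N → A x ∈ N
  isCompl : IsCompl M N

/-- `P` is the spectral projection of `A` relative to `s`: the bounded projection whose null space
`M` and range `N` form a reduction of `A` with `σ(A_M) = σ(A) \ s` and `σ(A_N) = s`. -/
def IsSpectralProjection (A : X →ₗ.[ℂ] X) (s : Set ℂ) (P : X →L[ℂ] X) : Prop :=
  IsIdempotentElem P ∧
    ∃ h : IsReduction A (LinearMap.ker (P : X →ₗ[ℂ] X)) (LinearMap.range (P : X →ₗ[ℂ] X)),
      spec (part A _ h.map_left) = spec A \ s ∧ spec (part A _ h.map_right) = s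

/-- `R` is a bounded everywhere defined two-sided inverse of `T`. -/
def IsBoundedInverse (T : X →ₗ.[ℂ] X) (R : X →L[ℂ] X) : Prop :=
  (∀ x : X, (R x, x) ∈ T.graph) ∧ ∀ x : T.domain, R (T x) = x

/-- `B = (A - ξ P)⁻¹ (I - P)` for some `ξ` with `|ξ| > 2 sup_{z ∈ s} |z|`, where `P` is the
spectral projection of `A` relative to `s`: the Drazin inverse of `A` related to `s`. -/
def IsRelDrazinInverse (A : X →ₗ.[ℂ] X) (s : Set ℂ) (P B : X →L[ℂ] X) : Prop :=
  IsSpectralProjection A s P ∧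
    ∃ (ξ : ℂ) (C : X →L[ℂ] X), 2 * sSup (norm '' s) < ‖ξ‖ ∧
      IsBoundedInverse (subLinear A (ξ • (P : X →ₗ[ℂ] X))) C ∧ B = C ∘L (1 - P)

/-- `B` is a generalized Drazin-Riesz inverse of `A`. -/
structure IsGenDrazinRieszInverse (A : X →ₗ.[ℂ] X) (B : X →L[ℂ] X) : Prop where
  range_subset : ∀ x : X, B x ∈ A.domain
  range_compl_subset : ∀ x : X, x - A ⟨B x, range_subset x⟩ ∈ A.domain
  inner : ∀ x : X, B (A ⟨B x, range_subset x⟩) = B x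
  comm : ∀ x : A.domain, B (A x) = A ⟨B x, range_subset x⟩
  riesz : ∃ R : X →L[ℂ] X,
    (∀ x : X, R x = A ⟨x - A ⟨B x, range_subset x⟩, range_compl_subset x⟩) ∧ IsRiesz R

/-- The product `A B` is everywhere defined and bounded. -/
def IsBoundedProd (A : X →ₗ.[ℂ] X) (B : X →L[ℂ] X) : Prop :=
  ∃ C : X →L[ℂ] X, ∀ x : X, (B x, C x) ∈ A.graph

open Classical in
/-- The bounded operator `A B`, when the product is everywhere defined and bounded
(and `0` otherwise). -/
def prodL (A : X →ₗ.[ℂ] X) (B : X →L[ℂ] X) : X →L[ℂ] X :=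
  if h : IsBoundedProd A B then h.choose else 0

/-- The spectral sets `σ_{n₀}` for a suitable `n₀`: bounded spectral sets that consist of `0` and
of Riesz points of `A`, and that some disc `D(0, r₀)` with `r₀ < 1/4` separates from the rest of
the spectrum. -/
structure IsSuitable (A : X →ₗ.[ℂ] X) (s : Set ℂ) : Prop where
  isBoundedSpectralSet : IsBoundedSpectralSet A s
  zero_mem : (0 : ℂ) ∈ s
  riesz : s \ {0} ⊆ rieszPoints A
  disc : ∃ r : ℝ, r < 1 / 4 ∧ s ⊆ Metric.ball 0 r ∧
    (Metric.ball 0 r \ {0}) ∩ (spec A \ s) = ∅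

end ClosedOp

end

/-!
Let `z` be a point outside the essential spectrum of `A`. Since `A - z` has range of finite
codimension, `D(Aⁿ⁺¹) = D(Aⁿ)` forces `D(A)` to have finite codimension, so `D(A)` is closed, being
the range of the bounded projection of the graph to the first factor, and dense, hence all of `X`:
the operator is bounded.

For bounded `A`, a point outside the Browder spectrum is not an accumulation point of the spectrum:
some power of `A - z` has complementary null space and range, hence its resolvent has at most a
simple pole at `0`. If `0` is isolated in `σ_b(A)`, all but countably many small circles around `0`
therefore miss `σ(A)`, and each of them cuts out a suitable set. Conversely every suitable set is
cut out by such a circle; the contour integral of the resolvent over it is a projection, and the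
Cauchy transforms of the resolvent invert `A - w` on its range and on its null space.

The Drazin inverse `B` commutes with `A` and satisfies `A B = 1 - P`. So `λ - A` is inverted on the
range of `P` by the Neumann series in `A P / λ`, on the null space of `P` by the one in `λ B`. As
for `A P` being Riesz, `A P - λ` is invertible if `λ ∉ σ ∪ {0}`, and it is a factor of `A - λ`,
hence Fredholm, if `λ` is a Riesz point. Its essential spectrum is not empty, because left
multiplication on the Calkin algebra sends Fredholm operators to units of a nontrivial Banach
algebra, where spectra are not empty.
-/

section FiniteCodimension

variable {K V W : Type*} [Field K] [AddCommGroup V] [Module K V] [AddCommGroup W] [Module K W]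

theorem coFG_comap {C : Submodule K W} (hC : C.CoFG) (f : V →ₗ[K] W) : (C.comap f).CoFG := by
  simpa only [LinearMap.ker_comp, Submodule.ker_mkQ] using Submodule.CoFG.ker (C.mkQ ∘ₗ f)

theorem coFG_map {f : V →ₗ[K] W} (hf : (LinearMap.range f).CoFG) {C : Submodule K V}
    (hC : C.CoFG) : (C.map f).CoFG := by
  obtain ⟨S, hS⟩ := C.exists_isCompl
  obtain ⟨T, hT⟩ := (LinearMap.range f).exists_isCompl
  refine ((hC.fg_of_isCompl hS).map f |>.sup (hf.fg_of_isCompl hT)).cofg_of_codisjoint ?_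
  rw [codisjoint_iff, sup_right_comm, ← Submodule.map_sup, sup_comm S, hS.sup_eq_top,
    Submodule.map_top, hT.sup_eq_top]

end FiniteCodimension

section Banach

variable {𝕜 X Y : Type*} [NormedAddCommGroup X] [NormedAddCommGroup Y]

theorem isClosed_range_of_isCompl [NontriviallyNormedField 𝕜] [NormedSpace 𝕜 X]
    [NormedSpace 𝕜 Y] [CompleteSpace X] [CompleteSpace Y] {f : X →L[𝕜] Y} {Z : Submodule 𝕜 Y}
    (hZ : IsCompl f.range Z) (hZclosed : IsClosed (Z : Set Y)) : IsClosed (f.range : Set Y) := by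
  have : IsClosed (f.ker : Set X) := f.isClosed_ker
  let g : (X ⧸ f.ker) →L[𝕜] Y := Submodule.liftQL _ f le_rfl
  have hg : g.range = f.range := Submodule.range_liftQ _ _ _
  rw [← hg] at hZ ⊢
  exact g.closed_complemented_range_of_isCompl_of_ker_eq_bot Z hZ hZclosed
    (Submodule.ker_liftQ_eq_bot _ _ _ le_rfl)

theorem isClosed_range_of_coFG [NontriviallyNormedField 𝕜] [CompleteSpace 𝕜] [NormedSpace 𝕜 X]
    [NormedSpace 𝕜 Y] [CompleteSpace X] [CompleteSpace Y] {f : X →L[𝕜] Y} (hf : f.range.CoFG) :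
    IsClosed (f.range : Set Y) := by
  obtain ⟨Z, hZ⟩ := f.range.exists_isCompl
  have : FiniteDimensional 𝕜 Z := Module.Finite.iff_fg.2 (hf.fg_of_isCompl hZ)
  exact isClosed_range_of_isCompl hZ Z.closed_of_finiteDimensional

theorem isStrictMap_of_isClosed_range [NontriviallyNormedField 𝕜] [NormedSpace 𝕜 X]
    [NormedSpace 𝕜 Y] [CompleteSpace X] [CompleteSpace Y] {f : X →L[𝕜] Y}
    (hf : IsClosed (f.range : Set Y)) : IsStrictMap f := by
  have : CompleteSpace f.range := hf.completeSpace_coe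
  exact f.rangeRestrict.isQuotientMap f.toLinearMap.surjective_rangeRestrict

theorem isFredholm_iff_finite_ker_coFG_range [RCLike 𝕜] [NormedSpace 𝕜 X] [NormedSpace 𝕜 Y]
    [CompleteSpace X] [CompleteSpace Y] {f : X →L[𝕜] Y} :
    f.IsFredholm ↔ FiniteDimensional 𝕜 f.ker ∧ f.range.CoFG := by
  refine ⟨fun h => ⟨h.finite_ker, h.finite_coker⟩, fun ⟨hker, hran⟩ => ?_⟩
  have hclosed := isClosed_range_of_coFG hran
  exact ⟨isStrictMap_of_isClosed_range hclosed, hclosed, hker, hran,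
    .of_finiteDimensional f.ker⟩

theorem isFredholm_of_bijective [RCLike 𝕜] [NormedSpace 𝕜 X] [NormedSpace 𝕜 Y]
    [CompleteSpace X] [CompleteSpace Y] {f : X →L[𝕜] Y} (hf : Function.Bijective f) :
    f.IsFredholm := by
  rw [isFredholm_iff_finite_ker_coFG_range, LinearMap.ker_eq_bot.2 hf.injective,
    LinearMap.range_eq_top.2 hf.surjective]
  exact ⟨inferInstance, .top⟩

theorem isFredholm_of_commute_of_isFredholm_mul [RCLike 𝕜] [NormedSpace 𝕜 X] [CompleteSpace X]
    {a b : X →L[𝕜] X} (hab : Commute a b) (h : (a * b).IsFredholm) : b.IsFredholm := by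
  obtain ⟨hker, hran⟩ := isFredholm_iff_finite_ker_coFG_range.1 h
  refine isFredholm_iff_finite_ker_coFG_range.2 ⟨?_, ?_⟩
  · have hle : b.ker ≤ (a * b).ker := LinearMap.ker_le_ker_comp b.toLinearMap a.toLinearMap
    exact Submodule.finiteDimensional_of_le hle
  · rw [hab.eq] at hran
    exact hran.of_le (LinearMap.range_comp_le_range a.toLinearMap b.toLinearMap)

end Banach

theorem mem_resolventSet_iff_bijective_sub_smul {𝕜 X : Type*} [NontriviallyNormedField 𝕜]
    [NormedAddCommGroup X] [NormedSpace 𝕜 X] [CompleteSpace X] {a : X →L[𝕜] X} {z : 𝕜} :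
    z ∈ resolventSet 𝕜 a ↔ Function.Bijective (a - z • 1 : X →L[𝕜] X) := by
  rw [spectrum.mem_resolventSet_iff, ← IsUnit.neg_iff, neg_sub, Algebra.algebraMap_eq_smul_one,
    ContinuousLinearMap.isUnit_iff_bijective]

namespace ClosedOp

section Algebraic

variable {E : Type*} [AddCommGroup E] [Module ℂ E]

theorem mem_graph_ofLinear (T : E →ₗ[ℂ] E) (x y : E) :
    (x, y) ∈ (ofLinear T).graph ↔ T x = y := by
  simp [ofLinear, LinearPMap.mem_graph_iff]

theorem eq_ofLinear_of_domain_eq_top {A : E →ₗ.[ℂ] E} (h : A.domain = ⊤) {T : E →ₗ[ℂ] E}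
    (hT : ∀ x : A.domain, A x = T x) : A = ofLinear T :=
  LinearPMap.ext h fun x hx _ => hT ⟨x, hx⟩

theorem bijective_ofLinear (T : E →ₗ[ℂ] E) :
    Function.Bijective (ofLinear T) ↔ Function.Bijective T :=
  Function.Bijective.of_comp_iff T (Submodule.topEquiv (R := ℂ) (M := E)).bijective

@[simp]
theorem nullSpace_ofLinear (T : E →ₗ[ℂ] E) : nullSpace (ofLinear T) = LinearMap.ker T := by
  ext x
  exact ⟨fun ⟨_, hy, hyx⟩ => hyx ▸ hy, fun hx => ⟨⟨x, trivial⟩, hx, rfl⟩⟩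

@[simp]
theorem rangeSpace_ofLinear (T : E →ₗ[ℂ] E) : rangeSpace (ofLinear T) = LinearMap.range T :=
  LinearMap.range_comp_of_range_eq_top T (Submodule.range_subtype ⊤)

theorem subLinear_ofLinear (T S : E →ₗ[ℂ] E) : subLinear (ofLinear T) S = ofLinear (T - S) :=
  eq_ofLinear_of_domain_eq_top rfl fun x => neg_add_eq_sub (S x) (T x)

theorem scalarSub_ofLinear (z : ℂ) (T : E →ₗ[ℂ] E) :
    scalarSub z (ofLinear T) = ofLinear (z • LinearMap.id - T) :=
  eq_ofLinear_of_domain_eq_top rfl fun x => (sub_eq_add_neg (z • (x : E)) (T x)).symm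

theorem mem_pcomp_domain (g f : E →ₗ.[ℂ] E) (x : E) :
    x ∈ (pcomp g f).domain ↔ ∃ h : x ∈ f.domain, f ⟨x, h⟩ ∈ g.domain :=
  ⟨fun ⟨⟨y, hy, hyx⟩, _⟩ => hyx ▸ ⟨y.2, hy⟩, fun ⟨hx, hfx⟩ => ⟨⟨⟨x, hx⟩, hfx, rfl⟩, hx⟩⟩

theorem mem_graph_pcomp (g f : E →ₗ.[ℂ] E) (x y : E) :
    (x, y) ∈ (pcomp g f).graph ↔ ∃ u, (x, u) ∈ f.graph ∧ (u, y) ∈ g.graph := by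
  constructor
  · intro h
    obtain ⟨⟨x, hx⟩, rfl, rfl⟩ := LinearPMap.mem_graph_iff _ |>.1 h
    obtain ⟨hf, hg⟩ := (mem_pcomp_domain g f x).1 hx
    exact ⟨_, f.mem_graph ⟨x, hf⟩, g.mem_graph ⟨_, hg⟩⟩
  · rintro ⟨u, hxu, huy⟩
    obtain ⟨x, rfl, rfl⟩ := LinearPMap.mem_graph_iff _ |>.1 hxu
    obtain ⟨v, hv, rfl⟩ := LinearPMap.mem_graph_iff _ |>.1 huy
    have hx := (mem_pcomp_domain g f x).2 ⟨x.2, (show (v : E) = f x from hv) ▸ v.2⟩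
    exact LinearPMap.mem_graph_iff _ |>.2 ⟨⟨x, hx⟩, rfl, congrArg g (Subtype.ext hv.symm)⟩

theorem pcomp_assoc (h g f : E →ₗ.[ℂ] E) : pcomp (pcomp h g) f = pcomp h (pcomp g f) := by
  refine LinearPMap.eq_of_eq_graph (Submodule.ext fun ⟨x, y⟩ => ?_)
  simp only [mem_graph_pcomp]
  grind

theorem pcomp_ofLinear (S T : E →ₗ[ℂ] E) :
    pcomp (ofLinear S) (ofLinear T) = ofLinear (S ∘ₗ T) := by
  refine LinearPMap.eq_of_eq_graph (Submodule.ext fun ⟨x, y⟩ => ?_)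
  simp only [mem_graph_pcomp, mem_graph_ofLinear, exists_eq_left', LinearMap.comp_apply]

theorem pow_succ_eq_pcomp_pow (A : E →ₗ.[ℂ] E) (n : ℕ) : pow A (n + 1) = pcomp (pow A n) A := by
  induction n with
  | zero =>
    refine LinearPMap.eq_of_eq_graph (Submodule.ext fun ⟨x, y⟩ => ?_)
    simp only [pow, mem_graph_pcomp, mem_graph_ofLinear, LinearMap.id_apply, exists_eq_left',
      exists_eq_right]
  | succ n ih =>
    calc pow A (n + 2) = pcomp A (pcomp (pow A n) A) := congrArg (pcomp A) ih
      _ = pcomp (pow A (n + 1)) A := (pcomp_assoc A (pow A n) A).symm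

theorem pow_ofLinear (T : E →ₗ[ℂ] E) (n : ℕ) : pow (ofLinear T) n = ofLinear (T ^ n) := by
  induction n with
  | zero => rfl
  | succ n ih => rw [pow, ih, pcomp_ofLinear, pow_succ']; rfl

end Algebraic

section Domain

variable {E : Type*} [AddCommGroup E] [Module ℂ E] (A : E →ₗ.[ℂ] E)

theorem mem_pow_succ_domain (n : ℕ) (x : A.domain) :
    (x : E) ∈ (pow A (n + 1)).domain ↔ A x ∈ (pow A n).domain := by
  rw [pow_succ_eq_pcomp_pow, mem_pcomp_domain]
  exact exists_prop_of_true x.2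

theorem antitone_pow_domain : Antitone fun n => (pow A n).domain :=
  antitone_nat_of_succ_le fun n x hx => ((mem_pcomp_domain _ (pow A n) x).1 hx).1

theorem mem_pow_succ_domain_iff_sub_smul_mem (z : ℂ) (n : ℕ) (x : A.domain) :
    (x : E) ∈ (pow A (n + 1)).domain ↔ A x - z • (x : E) ∈ (pow A n).domain := by
  have of_mem {n : ℕ} (hx : (x : E) ∈ (pow A n).domain) :
      (x : E) ∈ (pow A (n + 1)).domain ↔ A x - z • (x : E) ∈ (pow A n).domain := by
    rw [mem_pow_succ_domain, Submodule.sub_mem_iff_left _ (Submodule.smul_mem _ z hx)]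
  refine ⟨fun hx => (of_mem (antitone_pow_domain A n.le_succ hx)).1 hx, fun h => ?_⟩
  induction n with
  | zero => exact (of_mem (n := 0) Submodule.mem_top).2 h
  | succ n ih => exact (of_mem (ih (antitone_pow_domain A n.le_succ h))).2 h

theorem coFG_domain_of_pow_domain_stable {z : ℂ}
    (hran : (rangeSpace (subLinear A (z • LinearMap.id))).CoFG) {n : ℕ}
    (hn : (pow A (n + 1)).domain = (pow A n).domain) : A.domain.CoFG := by
  -- Each step replaces `C` by `(A - z) (C ∩ D(A))`, which has finite codimension again.
  suffices ∀ C : Submodule ℂ E, C.CoFG → C ⊓ (pow A n).domain ≤ (pow A (n + 1)).domain →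
      A.domain.CoFG from this ⊤ .top (inf_le_right.trans hn.ge)
  clear hn
  induction n with
  | zero =>
    refine fun C hC hle => hC.of_le fun x hx => ?_
    rw [zero_add, pow_succ_eq_pcomp_pow] at hle
    exact ((mem_pcomp_domain (pow A 0) A x).1 (hle ⟨hx, Submodule.mem_top⟩)).1
  | succ n ih =>
    intro C hC hle
    let T : A.domain →ₗ[ℂ] E := A.toFun - z • A.domain.subtype
    have hT : (subLinear A (z • LinearMap.id)).toFun = T :=
      LinearMap.ext fun x => neg_add_eq_sub (z • (x : E)) (A x)
    rw [rangeSpace, hT] at hran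
    refine ih _ (coFG_map hran (coFG_comap hC A.domain.subtype)) ?_
    rintro _ ⟨⟨x, hxC, rfl⟩, hx⟩
    have hx' := (mem_pow_succ_domain_iff_sub_smul_mem A z n x).2 hx
    exact (mem_pow_succ_domain_iff_sub_smul_mem A z (n + 1) x).1 (hle ⟨hxC, hx'⟩)

end Domain

section Bounded

variable {X : Type*} [NormedAddCommGroup X] [NormedSpace ℂ X]

theorem pow_ofLinear_coe (a : X →L[ℂ] X) (n : ℕ) :
    pow (ofLinear (a : X →ₗ[ℂ] X)) n = ofLinear ((a ^ n : X →L[ℂ] X) : X →ₗ[ℂ] X) := by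
  rw [pow_ofLinear, ContinuousLinearMap.toLinearMap_pow]

theorem scalarSub_ofLinear_coe (z : ℂ) (a : X →L[ℂ] X) :
    scalarSub z (ofLinear (a : X →ₗ[ℂ] X)) =
      ofLinear ((z • 1 - a : X →L[ℂ] X) : X →ₗ[ℂ] X) :=
  scalarSub_ofLinear z _

theorem subLinear_ofLinear_smul_id (a : X →L[ℂ] X) (z : ℂ) :
    subLinear (ofLinear (a : X →ₗ[ℂ] X)) (z • LinearMap.id) =
      ofLinear ((a - z • 1 : X →L[ℂ] X) : X →ₗ[ℂ] X) :=
  subLinear_ofLinear _ _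

theorem isBoundedProd_ofLinear (a b : X →L[ℂ] X) :
    IsBoundedProd (ofLinear (a : X →ₗ[ℂ] X)) b :=
  ⟨a * b, fun _ => (mem_graph_ofLinear _ _ _).2 rfl⟩

theorem prodL_ofLinear (a b : X →L[ℂ] X) : prodL (ofLinear (a : X →ₗ[ℂ] X)) b = a * b := by
  have h := isBoundedProd_ofLinear a b
  rw [prodL, dif_pos h]
  ext x
  exact ((mem_graph_ofLinear _ _ _).1 (h.choose_spec x)).symm

theorem isBoundedInverse_ofLinear_iff (u c : X →L[ℂ] X) :
    IsBoundedInverse (ofLinear (u : X →ₗ[ℂ] X)) c ↔ u * c = 1 ∧ c * u = 1 := by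
  simp only [IsBoundedInverse, mem_graph_ofLinear, ContinuousLinearMap.ext_iff]
  exact and_congr Iff.rfl ⟨fun h x => h ⟨x, trivial⟩, fun h x => h x⟩

variable [CompleteSpace X]

theorem mem_resolventSet_ofLinear (a : X →L[ℂ] X) (z : ℂ) :
    z ∈ resolventSet (ofLinear (a : X →ₗ[ℂ] X)) ↔ z ∈ _root_.resolventSet ℂ a := by
  rw [resolventSet, Set.mem_ofPred_eq, scalarSub_ofLinear_coe, bijective_ofLinear,
    spectrum.mem_resolventSet_iff, Algebra.algebraMap_eq_smul_one,
    ContinuousLinearMap.isUnit_iff_bijective]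
  rfl

theorem spec_ofLinear (a : X →L[ℂ] X) : spec (ofLinear (a : X →ₗ[ℂ] X)) = spectrum ℂ a :=
  compl_inj_iff.2 (Set.ext (mem_resolventSet_ofLinear a))

theorem isFredholm_ofLinear_iff (a : X →L[ℂ] X) :
    IsFredholm (ofLinear (a : X →ₗ[ℂ] X)) ↔ a.IsFredholm := by
  rw [isFredholm_iff_finite_ker_coFG_range]
  constructor
  · rintro ⟨-, hker, hran⟩
    rw [nullSpace_ofLinear] at hker
    rw [rangeSpace_ofLinear] at hran
    exact ⟨hker, hran⟩
  · rintro ⟨hker, hran⟩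
    rw [← nullSpace_ofLinear] at hker
    have hclosed := isClosed_range_of_coFG hran
    rw [← rangeSpace_ofLinear] at hran hclosed
    exact ⟨hclosed, hker, hran⟩

theorem mem_essSpec_ofLinear (a : X →L[ℂ] X) (z : ℂ) :
    z ∈ essSpec (ofLinear (a : X →ₗ[ℂ] X)) ↔ ¬ (a - z • 1).IsFredholm := by
  rw [essSpec, Set.mem_ofPred_eq, subLinear_ofLinear_smul_id, isFredholm_ofLinear_iff]

theorem exists_eq_ofLinear_of_isClosed {A : X →ₗ.[ℂ] X} (hA : A.IsClosed) (hdom : A.domain = ⊤) :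
    ∃ a : X →L[ℂ] X, A = ofLinear (a : X →ₗ[ℂ] X) := by
  let T : X →ₗ[ℂ] X := A.toFun ∘ₗ LinearMap.id.codRestrict A.domain fun _ => hdom ▸ trivial
  have hAT : A = ofLinear T := eq_ofLinear_of_domain_eq_top hdom fun _ => rfl
  have hgraph : T.graph = A.graph := by
    ext ⟨x, y⟩
    rw [hAT, mem_graph_ofLinear, LinearMap.mem_graph_iff, eq_comm]
  exact ⟨.ofIsClosedGraph (g := T) (hgraph ▸ hA), hAT⟩

theorem domain_eq_top_of_coFG {A : X →ₗ.[ℂ] X} (hA : A.IsClosed)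
    (hdense : Dense (A.domain : Set X)) (hcofg : A.domain.CoFG) : A.domain = ⊤ := by
  have : CompleteSpace A.graph := IsClosed.completeSpace_coe (hs := hA)
  let fstGraph : A.graph →L[ℂ] X := .fst ℂ X X ∘L A.graph.subtypeL
  have hran : fstGraph.range = A.domain :=
    calc fstGraph.range = (LinearMap.range A.graph.subtype).map (LinearMap.fst ℂ X X) :=
          LinearMap.range_comp _ _
      _ = A.domain := by rw [Submodule.range_subtype, LinearPMap.graph_map_fst_eq_domain]
  have hclosed : IsClosed (A.domain : Set X) := hran ▸ isClosed_range_of_coFG (hran ▸ hcofg)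
  exact SetLike.coe_injective (hclosed.closure_eq.symm.trans hdense.closure_eq)

theorem MemChat.exists_eq_ofLinear {A : X →ₗ.[ℂ] X} (hA : MemChat A) :
    ∃ a : X →L[ℂ] X, A = ofLinear (a : X →ₗ[ℂ] X) := by
  obtain ⟨z, hz⟩ := hA.essResolvent_nonempty
  obtain ⟨J, hJ⟩ := hA.domain_stabilizes
  have hcofg := coFG_domain_of_pow_domain_stable A (not_not.1 hz).finite_codim (hJ J le_rfl)
  exact exists_eq_ofLinear_of_isClosed hA.isClosed
    (domain_eq_top_of_coFG hA.isClosed hA.dense_domain hcofg)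

end Bounded

end ClosedOp

section OuterInverse

/-- `b` is an outer inverse of `a` commuting with `a`: it inverts `a` on the range of the
idempotent `a * b` and is zero on the complement. Drazin inverses are of this kind. -/
structure IsCommutingOuterInverse {R : Type*} [Ring R] (a b : R) : Prop where
  commute : Commute a b
  mul_mul_self : b * a * b = b

section Ring

variable {R : Type*} [Ring R] {a b : R}

theorem IsCommutingOuterInverse.isIdempotentElem_mul (h : IsCommutingOuterInverse a b) :
    IsIdempotentElem (a * b) := by
  rw [IsIdempotentElem, mul_assoc, ← mul_assoc b a b, h.mul_mul_self]

theorem IsCommutingOuterInverse.commute_one_sub_mul (h : IsCommutingOuterInverse a b) :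
    Commute a (1 - a * b) :=
  (Commute.one_right a).sub_right ((Commute.refl a).mul_right h.commute)

theorem IsCommutingOuterInverse.mul_pow_add_two (h : IsCommutingOuterInverse a b) (n : ℕ) :
    a * b ^ (n + 2) = b ^ (n + 1) := by
  rw [pow_succ' b (n + 1), pow_succ' b n, ← mul_assoc, h.commute.eq, ← mul_assoc (b * a),
    h.mul_mul_self]

end Ring

section Algebra

variable {𝕜 R : Type*} [CommSemiring 𝕜] [Ring R] [Algebra 𝕜 R] {a p c : R} {ξ : 𝕜}

theorem mul_mul_one_sub_of_inverse_sub_smul (hp : IsIdempotentElem p) (hap : Commute a p)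
    (hc : (a - ξ • p) * c = 1) (hc' : c * (a - ξ • p) = 1) : a * (c * (1 - p)) = 1 - p := by
  have hpc : Commute (1 - p) c :=
    Commute.units_inv_right (u := ⟨a - ξ • p, c, hc, hc'⟩) <| (Commute.one_left _).sub_left <|
      hap.symm.sub_right ((Commute.refl p).smul_right ξ)
  calc a * (c * (1 - p)) = a * (1 - p) * c := by rw [← hpc.eq, mul_assoc]
    _ = (a - ξ • p) * (1 - p) * c := by rw [sub_mul, smul_mul_assoc, hp.mul_one_sub_self,
      smul_zero, sub_zero]
    _ = (1 - p) * ((a - ξ • p) * c) := by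
      rw [← mul_assoc, ((Commute.one_right _).sub_right
        (hap.sub_left ((Commute.refl p).smul_left ξ))).eq]
    _ = 1 - p := by rw [hc, mul_one]

theorem isCommutingOuterInverse_of_inverse_sub_smul (hp : IsIdempotentElem p)
    (hap : Commute a p) (hc : (a - ξ • p) * c = 1) (hc' : c * (a - ξ • p) = 1) :
    IsCommutingOuterInverse a (c * (1 - p)) where
  commute := by
    have hac : Commute a c := Commute.units_inv_right (u := ⟨a - ξ • p, c, hc, hc'⟩) <|
      (Commute.refl a).sub_right (hap.smul_right ξ)
    exact hac.mul_right ((Commute.one_right a).sub_right hap)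
  mul_mul_self := by
    rw [mul_assoc, mul_mul_one_sub_of_inverse_sub_smul hp hap hc hc', mul_assoc, hp.one_sub.eq]

end Algebra

section Laurent

variable {𝒜 : Type*} [NormedRing 𝒜] [NormedAlgebra ℂ 𝒜] [CompleteSpace 𝒜]

theorem summable_smul_pow_of_lt_inv_spectralRadius (c : 𝒜) {w : ℂ}
    (hw : ‖w‖ₑ < (spectralRadius ℂ c)⁻¹) : Summable fun n : ℕ => w ^ n • c ^ n := by
  obtain ⟨r, hwr, hr⟩ := ENNReal.lt_iff_exists_nnreal_btwn.1 hw
  have hseries := (spectrum.hasFPowerSeriesOnBall_inverse_one_sub_smul ℂ c).exchange_radius <|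
    (spectrum.differentiableOn_inverse_one_sub_smul hr).hasFPowerSeriesOnBall
      (ENNReal.coe_pos.1 (pos_of_gt hwr))
  simpa [ContinuousMultilinearMap.mkPiRing_apply] using
    (hseries.hasSum (y := w) (by rwa [Metric.mem_eball, edist_zero_right])).summable

theorem exists_hasSum_principal_part {a p : 𝒜} (hp : IsIdempotentElem p) (hap : Commute a p)
    {z : ℂ} (hz : spectralRadius ℂ (a * p) < ‖z‖ₑ) :
    ∃ S : 𝒜, HasSum (fun n : ℕ => (z ^ (n + 1))⁻¹ • (a ^ n * p)) S ∧ Commute a S ∧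
      z • S - a * S = p := by
  have hz0 : z ≠ 0 := enorm_ne_zero.1 (pos_of_gt hz).ne'
  let f : ℕ → 𝒜 := fun n => (z ^ (n + 1))⁻¹ • (a ^ n * p)
  have hf : Summable f := by
    have hw : ‖z⁻¹‖ₑ < (spectralRadius ℂ (a * p))⁻¹ := enorm_inv hz0 ▸ ENNReal.inv_lt_inv.2 hz
    refine (((summable_smul_pow_of_lt_inv_spectralRadius _ hw).mul_right p).const_smul z⁻¹).congr
      fun n => ?_
    rw [hap.mul_pow, smul_mul_assoc, mul_assoc, ← pow_succ, hp.pow_succ_eq, smul_smul,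
      ← pow_succ', inv_pow]
  have hstep (n : ℕ) : a * f n = z • f (n + 1) := by
    simp only [f]
    rw [mul_smul_comm, ← mul_assoc, ← pow_succ', smul_smul, pow_succ' z (n + 1), mul_inv,
      mul_inv_cancel_left₀ hz0]
  refine ⟨∑' n, f n, hf.hasSum, .tsum_right _ fun n => ?_, ?_⟩
  · exact (((Commute.refl a).pow_right n).mul_right hap).smul_right _
  · have htail : z • (∑' n, f n - f 0) = a * ∑' n, f n := by
      rw [hf.tsum_eq_zero_add, add_sub_cancel_left, ← hf.tsum_eq_zero_add, ← hf.tsum_mul_left,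
        ← tsum_const_smul'' z]
      exact tsum_congr fun n => (hstep n).symm
    have hzero : z • f 0 = p := by simp [f, hz0]
    rw [← htail, smul_sub, hzero, sub_sub_cancel]

theorem IsCommutingOuterInverse.exists_hasSum_regular_part {a b : 𝒜}
    (h : IsCommutingOuterInverse a b) {z : ℂ} (hz : ‖z‖ₑ < (spectralRadius ℂ b)⁻¹) :
    ∃ T : 𝒜, HasSum (fun n : ℕ => z ^ n • b ^ (n + 1)) T ∧ Commute a T ∧
      a * T - z • T = a * b := by
  let g : ℕ → 𝒜 := fun n => z ^ n • b ^ (n + 1)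
  have hg : Summable g := by
    refine ((summable_smul_pow_of_lt_inv_spectralRadius b hz).mul_right b).congr fun n => ?_
    rw [smul_mul_assoc, ← pow_succ]
  have hstep (n : ℕ) : a * g (n + 1) = z • g n := by
    simp only [g]
    rw [mul_smul_comm, h.mul_pow_add_two, smul_smul, pow_succ']
  refine ⟨∑' n, g n, hg.hasSum, .tsum_right _ fun n => ?_, ?_⟩
  · exact (h.commute.pow_right _).smul_right _
  · have htail : a * (∑' n, g n - g 0) = z • ∑' n, g n := by
      rw [hg.tsum_eq_zero_add, add_sub_cancel_left, ← hg.tsum_eq_zero_add,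
        ← ((summable_nat_add_iff 1).2 hg).tsum_mul_left, ← tsum_const_smul'' z]
      exact tsum_congr hstep
    have hzero : g 0 = b := by simp [g]
    rw [← htail, mul_sub, hzero, sub_sub_cancel]

theorem IsCommutingOuterInverse.exists_laurent_hasSum {a b : 𝒜}
    (h : IsCommutingOuterInverse a b) {z : ℂ}
    (hz : spectralRadius ℂ (a * (1 - a * b)) < ‖z‖ₑ) (hz' : ‖z‖ₑ < (spectralRadius ℂ b)⁻¹) :
    ∃ S T : 𝒜, HasSum (fun n : ℕ => (z ^ (n + 1))⁻¹ • (a ^ n * (1 - a * b))) S ∧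
      HasSum (fun n : ℕ => z ^ n • b ^ (n + 1)) T ∧
      (z • 1 - a) * (S - T) = 1 ∧ (S - T) * (z • 1 - a) = 1 := by
  obtain ⟨S, hS, haS, hzS⟩ :=
    exists_hasSum_principal_part h.isIdempotentElem_mul.one_sub h.commute_one_sub_mul hz
  obtain ⟨T, hT, haT, hzT⟩ := h.exists_hasSum_regular_part hz'
  have hleft : (z • 1 - a) * (S - T) = 1 := by
    calc (z • 1 - a) * (S - T) = (z • S - a * S) + (a * T - z • T) := by
          simp only [sub_mul, mul_sub, smul_mul_assoc, one_mul]; abel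
      _ = 1 := by rw [hzS, hzT, sub_add_cancel]
  have hcomm : Commute (z • 1 - a) (S - T) :=
    ((Commute.one_left _).smul_left z).sub_left (haS.sub_right haT)
  exact ⟨S, T, hS, hT, hleft, hcomm.eq ▸ hleft⟩

end Laurent

end OuterInverse

section AscentDescent

variable {K V : Type*} [DivisionRing K] [AddCommGroup V] [Module K V] {f : Module.End K V}

theorem isCompl_ker_range_of_mul_self (hker : LinearMap.ker (f * f) = LinearMap.ker f)
    (hran : LinearMap.range (f * f) = LinearMap.range f) :
    IsCompl (LinearMap.ker f) (LinearMap.range f) := by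
  refine ⟨Submodule.disjoint_def.2 ?_, codisjoint_iff_le_sup.2 fun x _ => ?_⟩
  · rintro _ hx ⟨x, rfl⟩
    exact hker.le (show x ∈ LinearMap.ker (f * f) from hx)
  · obtain ⟨y, hy⟩ := hran.ge ⟨x, rfl⟩
    refine Submodule.mem_sup.2 ⟨x - f y, ?_, f y, ⟨y, rfl⟩, sub_add_cancel x (f y)⟩
    rw [LinearMap.mem_ker, map_sub, sub_eq_zero]
    exact hy.symm

theorem range_pow_constant {n : ℕ} (h : LinearMap.range (f ^ n) = LinearMap.range (f ^ (n + 1)))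
    (k : ℕ) : LinearMap.range (f ^ (n + k)) = LinearMap.range (f ^ n) := by
  have hmap (m : ℕ) : LinearMap.range (f ^ (m + 1)) = (LinearMap.range (f ^ m)).map f := by
    rw [pow_succ']
    exact LinearMap.range_comp _ _
  induction k with
  | zero => rfl
  | succ k ih => rw [← add_assoc, hmap, ih, ← hmap, ← h]

theorem exists_isCompl_ker_pow_range_pow
    (hker : ∃ n, LinearMap.ker (f ^ n) = LinearMap.ker (f ^ (n + 1)))
    (hran : ∃ n, LinearMap.range (f ^ n) = LinearMap.range (f ^ (n + 1))) :
    ∃ p ≠ 0, IsCompl (LinearMap.ker (f ^ p)) (LinearMap.range (f ^ p)) := by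
  obtain ⟨m, hm⟩ := hker
  obtain ⟨n, hn⟩ := hran
  refine ⟨m + n + 1, Nat.succ_ne_zero _, isCompl_ker_range_of_mul_self ?_ ?_⟩
  · rw [← pow_add, show m + n + 1 + (m + n + 1) = m + (n + 1 + (m + n + 1)) by ring,
      show m + n + 1 = m + (n + 1) by ring, ← Module.End.ker_pow_constant hm,
      ← Module.End.ker_pow_constant hm]
  · rw [← pow_add, show m + n + 1 + (m + n + 1) = n + (m + 1 + (m + n + 1)) by ring,
      show m + n + 1 = n + (m + 1) by ring, range_pow_constant hn, range_pow_constant hn]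

end AscentDescent

section IsolatedPoints

theorem IsCommutingOuterInverse.eventually_mem_resolventSet {𝒜 : Type*} [NormedRing 𝒜]
    [NormedAlgebra ℂ 𝒜] [CompleteSpace 𝒜] {a b : 𝒜} (h : IsCommutingOuterInverse a b)
    (hquasi : spectralRadius ℂ (a * (1 - a * b)) = 0) :
    ∀ᶠ z in 𝓝[≠] (0 : ℂ), z ∈ resolventSet ℂ a := by
  have hpos : 0 < (spectralRadius ℂ b)⁻¹ := ENNReal.inv_pos.2 <| ne_top_of_le_ne_top
    (by finiteness) (spectrum.spectralRadius_le_pow_nnnorm_pow_one_div ℂ b 0)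
  have hsmall : ∀ᶠ z in 𝓝[≠] (0 : ℂ), ‖z‖ₑ < (spectralRadius ℂ b)⁻¹ :=
    nhdsWithin_le_nhds <| continuous_enorm.continuousAt.eventually_lt continuousAt_const <| by
      rwa [enorm_zero]
  filter_upwards [hsmall, self_mem_nhdsWithin] with z hz hz0
  obtain ⟨S, T, -, -, hleft, hright⟩ := h.exists_laurent_hasSum
    (hquasi ▸ enorm_pos.2 hz0) hz
  rw [spectrum.mem_resolventSet_iff, Algebra.algebraMap_eq_smul_one]
  exact ⟨⟨_, _, hleft, hright⟩, rfl⟩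

variable {X : Type*} [NormedAddCommGroup X] [NormedSpace ℂ X] [CompleteSpace X]

theorem exists_isCommutingOuterInverse_of_isCompl_ker_range {a : X →L[ℂ] X}
    (h : IsCompl a.ker a.range) :
    ∃ b : X →L[ℂ] X, IsCommutingOuterInverse a b ∧ a * (1 - a * b) = 0 := by
  have htop : Submodule.IsTopCompl a.ker a.range :=
    Submodule.IsCompl.isTopCompl_of_isClosed h a.isClosed_ker
      (isClosed_range_of_isCompl h.symm a.isClosed_ker)
  let p : X →L[ℂ] X := a.ker.projectionL a.range htop
  have hp : IsIdempotentElem p := Submodule.isIdempotentElem_projectionL htop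
  have hpker {x : X} (hx : a x = 0) : p x = x := Submodule.projectionL_apply_left htop ⟨x, hx⟩
  have hpran (x : X) : p (a x) = 0 := Submodule.projectionL_apply_right htop ⟨a x, x, rfl⟩
  have hap (x : X) : a (p x) = 0 := Submodule.projectionL_apply_mem htop x
  have hcomm : Commute a p := ContinuousLinearMap.ext fun x => (hap x).trans (hpran x).symm
  have hbij : Function.Bijective (a - (1 : ℂ) • p) := by
    rw [one_smul]
    refine ⟨(injective_iff_map_eq_zero _).2 fun x hx => ?_, fun y => ?_⟩
    · have hax : a x = p x := sub_eq_zero.1 hx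
      have hpx : p x = 0 := by rw [← hpker (hap x), ← hax, hpran]
      rw [← hpker (hax.trans hpx), hpx]
    · obtain ⟨k, hk, _, ⟨w, rfl⟩, rfl⟩ :=
        Submodule.mem_sup.1 (h.sup_eq_top ▸ Submodule.mem_top (x := y))
      obtain ⟨l, hl, _, ⟨v, rfl⟩, rfl⟩ :=
        Submodule.mem_sup.1 (h.sup_eq_top ▸ Submodule.mem_top (x := w))
      rw [LinearMap.mem_ker, ContinuousLinearMap.coe_coe] at hk hl
      refine ⟨a v - k, ?_⟩
      simp [hpran, hpker hk, hk, hl, add_comm]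
  obtain ⟨⟨_, c, hc, hc'⟩, rfl⟩ := ContinuousLinearMap.isUnit_iff_bijective.2 hbij
  refine ⟨c * (1 - p), isCommutingOuterInverse_of_inverse_sub_smul hp hcomm hc hc', ?_⟩
  rw [mul_mul_one_sub_of_inverse_sub_smul hp hcomm hc hc', sub_sub_cancel]
  exact ContinuousLinearMap.ext hap

/-- Passing to a power `aᵖ` whose null space and range are complementary makes the singularity at
`0` a simple pole; the spectral mapping theorem transfers isolation back to `a`. -/
theorem eventually_mem_resolventSet_of_ascent_descent {a : X →L[ℂ] X}
    (hker : ∃ n, (a ^ n).ker = (a ^ (n + 1)).ker)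
    (hran : ∃ n, (a ^ n).range = (a ^ (n + 1)).range) :
    ∀ᶠ z in 𝓝[≠] (0 : ℂ), z ∈ resolventSet ℂ a := by
  simp only [ContinuousLinearMap.toLinearMap_pow] at hker hran
  obtain ⟨p, hp0, hcompl⟩ := exists_isCompl_ker_pow_range_pow hker hran
  rw [← ContinuousLinearMap.toLinearMap_pow] at hcompl
  obtain ⟨b, hb, hab⟩ := exists_isCommutingOuterInverse_of_isCompl_ker_range hcompl
  have hpow : Tendsto (fun z : ℂ => z ^ p) (𝓝[≠] 0) (𝓝[≠] 0) :=
    ((continuous_pow p).tendsto' 0 0 (zero_pow hp0)).inf <|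
      tendsto_principal_principal.2 fun z hz => pow_ne_zero p hz
  have hpres := hb.eventually_mem_resolventSet (hab ▸ spectrum.spectralRadius_zero)
  filter_upwards [hpow.eventually hpres] with z hz
  exact not_not.1 fun hmem => spectrum.pow_mem_pow a p hmem hz

end IsolatedPoints

section Sphere

open Metric

theorem exists_disjoint_sphere_of_discrete {E : Type*} [PseudoMetricSpace E]
    [SecondCountableTopology E] {K : Set E} {c : E} {ε : ℝ} (hε : 0 < ε)
    (hK : ∀ z ∈ ball c ε, 0 < dist z c → ∀ᶠ w in 𝓝[≠] z, w ∉ K) :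
    ∃ r ∈ Set.Ioo 0 ε, Disjoint (sphere c r) K := by
  let F : Set E := {z ∈ K | z ∈ ball c ε ∧ 0 < dist z c}
  have hdiscrete : DiscreteTopology F := discreteTopology_subtype_iff.2 fun z hz => by
    rw [← disjoint_iff, disjoint_principal_right]
    exact (hK z hz.2.1 hz.2.2).mono fun w hw hwF => hw hwF.1
  have hF : F.Countable := Set.countable_coe_iff.1 countable_of_Lindelof_of_discrete
  obtain ⟨r, hr, hrF⟩ := ((hF.image (dist · c)).dense_compl ℝ).inter_open_nonempty
    (Set.Ioo 0 ε) isOpen_Ioo (Set.nonempty_Ioo.2 hε)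
  refine ⟨r, hr, Set.disjoint_left.2 fun z hzr hzK => hrF ⟨z, ⟨hzK, ?_, ?_⟩, hzr⟩⟩
  · exact mem_ball.2 ((mem_sphere.1 hzr).trans_lt hr.2)
  · exact (mem_sphere.1 hzr).symm ▸ hr.1

end Sphere

namespace ClosedOp

section Suitable

open Metric

variable {X : Type*} [NormedAddCommGroup X] [NormedSpace ℂ X] [CompleteSpace X]

theorem eventually_mem_resolventSet_of_notMem_browderSpec {a : X →L[ℂ] X} {z : ℂ}
    (hz : z ∉ browderSpec (ofLinear (a : X →ₗ[ℂ] X))) :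
    ∀ᶠ w in 𝓝[≠] z, w ∈ _root_.resolventSet ℂ a := by
  have hb : IsBrowder (ofLinear ((a - z • 1 : X →L[ℂ] X) : X →ₗ[ℂ] X)) := by
    rw [← subLinear_ofLinear_smul_id]
    exact not_not.1 hz
  have hker := hb.finite_ascent
  have hran := hb.finite_descent
  simp only [pow_ofLinear_coe, nullSpace_ofLinear, rangeSpace_ofLinear] at hker hran
  have hshift : Tendsto (fun w => w - z) (𝓝[≠] z) (𝓝[≠] 0) :=
    ((continuous_sub_right z).tendsto' z 0 (sub_self z)).inf <|
      tendsto_principal_principal.2 fun w hw => sub_ne_zero.2 hw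
  filter_upwards [hshift.eventually (eventually_mem_resolventSet_of_ascent_descent hker hran)]
    with w hw
  rw [spectrum.mem_resolventSet_iff] at hw ⊢
  convert hw using 1
  rw [map_sub, Algebra.algebraMap_eq_smul_one z, sub_sub_sub_cancel_right]

theorem browderSpec_subset_spectrum (a : X →L[ℂ] X) :
    browderSpec (ofLinear (a : X →ₗ[ℂ] X)) ⊆ spectrum ℂ a := by
  intro z hz hres
  have hbij : Function.Bijective (a - z • 1 : X →L[ℂ] X) :=
    mem_resolventSet_iff_bijective_sub_smul.1 hres
  have hker : (a - z • 1 : X →L[ℂ] X).ker = ⊥ := LinearMap.ker_eq_bot.2 hbij.1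
  have hran : (a - z • 1 : X →L[ℂ] X).range = ⊤ := LinearMap.range_eq_top.2 hbij.2
  refine hz ?_
  rw [subLinear_ofLinear_smul_id]
  refine ⟨?_, ⟨0, ?_⟩, ⟨0, ?_⟩⟩
  · exact (isFredholm_ofLinear_iff _).2 (isFredholm_of_bijective hbij)
  · rw [zero_add, pow_ofLinear_coe, pow_ofLinear_coe, nullSpace_ofLinear, nullSpace_ofLinear,
      pow_zero, pow_one, hker]
    exact LinearMap.ker_id
  · rw [zero_add, pow_ofLinear_coe, pow_ofLinear_coe, rangeSpace_ofLinear, rangeSpace_ofLinear,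
      pow_zero, pow_one, hran]
    exact LinearMap.range_id

theorem isBoundedSpectralSet_inter_ball {a : X →L[ℂ] X} {r : ℝ}
    (hr : Disjoint (sphere 0 r) (spectrum ℂ a)) :
    IsBoundedSpectralSet (ofLinear (a : X →ₗ[ℂ] X)) (spectrum ℂ a ∩ ball 0 r) := by
  have hclosed : spectrum ℂ a ∩ ball 0 r = spectrum ℂ a ∩ closedBall 0 r := by
    rw [← ball_union_sphere, Set.inter_union_distrib_left, hr.symm.inter_eq, Set.union_empty]
  refine ⟨isBounded_ball.subset Set.inter_subset_right, ?_, ?_, ?_⟩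
  · rw [specInfty, spec_ofLinear]
    exact (Set.image_mono Set.inter_subset_left).trans Set.subset_union_left
  · have hcompact : IsCompact (spectrum ℂ a ∩ ball 0 r) :=
      hclosed ▸ (spectrum.isCompact a).inter_right isClosed_closedBall
    exact (hcompact.image OnePoint.continuous_coe).isClosed.preimage continuous_subtype_val
  · have hopen : IsOpen (((↑) : ℂ → OnePoint ℂ) '' ball 0 r) :=
      OnePoint.isOpenEmbedding_coe.isOpenMap _ isOpen_ball
    convert hopen.preimage continuous_subtype_val using 1
    rw [Subtype.preimage_val_eq_preimage_val_iff, specInfty, spec_ofLinear]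
    ext x
    induction x <;> simp [OnePoint.coe_injective.eq_iff]

theorem exists_isSuitable {a : X →L[ℂ] X}
    (h : (0 : ℂ) ∈ isoPts (browderSpec (ofLinear (a : X →ₗ[ℂ] X)))) :
    ∃ s : Set ℂ, IsSuitable (ofLinear (a : X →ₗ[ℂ] X)) s := by
  have hisolated : ∀ᶠ z in 𝓝[≠] (0 : ℂ), z ∉ browderSpec (ofLinear (a : X →ₗ[ℂ] X)) :=
    not_frequently.1 (accPt_iff_frequently_nhdsNE.not.1 h.2)
  obtain ⟨ε, hε, hball⟩ := mem_nhdsWithin_iff.1 hisolated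
  obtain ⟨r, ⟨hr0, hr⟩, hsphere⟩ : ∃ r ∈ Set.Ioo 0 (min ε (1 / 4)),
      Disjoint (sphere (0 : ℂ) r) (spectrum ℂ a) := by
    refine exists_disjoint_sphere_of_discrete (lt_min hε (by norm_num)) fun z hz hz0 => ?_
    have hzε : z ∈ ball 0 ε ∩ {0}ᶜ := ⟨ball_subset_ball (min_le_left _ _) hz, dist_pos.1 hz0⟩
    exact (eventually_mem_resolventSet_of_notMem_browderSpec (hball hzε)).mono
      fun w hw => not_not.2 hw
  refine ⟨spectrum ℂ a ∩ ball 0 r, isBoundedSpectralSet_inter_ball hsphere,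
    ⟨browderSpec_subset_spectrum a h.1, mem_ball_self hr0⟩, ?_, r, hr.trans_le (min_le_right _ _),
    Set.inter_subset_right, ?_⟩
  · rintro z ⟨⟨hz, hzr⟩, hz0⟩
    have hzε : z ∈ ball 0 ε := ball_subset_ball (hr.le.trans (min_le_left _ _)) hzr
    exact ⟨(spec_ofLinear a).symm ▸ hz, hball ⟨hzε, hz0⟩⟩
  · rw [spec_ofLinear, Set.sdiff_self_inter, ← Set.disjoint_iff_inter_eq_empty]
    exact Set.disjoint_left.2 fun z hz hz' => hz'.2 hz.1

end Suitable

end ClosedOp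

section Annulus

open Metric

variable {E : Type*} [PseudoMetricSpace E] {c : E} {r₁ r₂ : ℝ}

theorem sphere_subset_closedBall_diff_ball_left (h : r₁ ≤ r₂) :
    sphere c r₁ ⊆ closedBall c r₂ \ ball c r₁ := fun _ hz =>
  ⟨mem_closedBall.2 ((mem_sphere.1 hz).trans_le h), fun h' => (mem_ball.1 h').ne hz⟩

theorem sphere_subset_closedBall_diff_ball_right (h : r₁ ≤ r₂) :
    sphere c r₂ ⊆ closedBall c r₂ \ ball c r₁ := fun _ hz =>
  ⟨sphere_subset_closedBall hz, fun h' => (h.trans_eq hz.symm).not_gt h'⟩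

end Annulus

section CircleIntegral

open Metric

theorem map_circleIntegral {F G : Type*} [NormedAddCommGroup F] [NormedSpace ℂ F]
    [CompleteSpace F] [NormedAddCommGroup G] [NormedSpace ℂ G] [CompleteSpace G] (L : F →L[ℂ] G)
    {f : ℂ → F} {c : ℂ} {r : ℝ} (hf : CircleIntegrable f c r) :
    L (∮ z in C(c, r), f z) = ∮ z in C(c, r), L (f z) := by
  simp only [circleIntegral, ← map_smul]
  exact (L.intervalIntegral_comp_comm hf.out).symm

variable {𝒜 : Type*} [NormedRing 𝒜] [NormedAlgebra ℂ 𝒜] [CompleteSpace 𝒜]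
  {f : ℂ → 𝒜} {c : ℂ} {r : ℝ}

theorem mul_circleIntegral (b : 𝒜) (hf : CircleIntegrable f c r) :
    b * ∮ z in C(c, r), f z = ∮ z in C(c, r), b * f z :=
  map_circleIntegral (ContinuousLinearMap.mul ℂ 𝒜 b) hf

theorem circleIntegral_mul (b : 𝒜) (hf : CircleIntegrable f c r) :
    (∮ z in C(c, r), f z) * b = ∮ z in C(c, r), f z * b :=
  map_circleIntegral ((ContinuousLinearMap.mul ℂ 𝒜).flip b) hf

theorem commute_circleIntegral {b : 𝒜} (hr : 0 ≤ r) (hf : CircleIntegrable f c r)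
    (hb : ∀ z ∈ sphere c r, Commute b (f z)) : Commute b (∮ z in C(c, r), f z) := by
  rw [commute_iff_eq, mul_circleIntegral b hf, circleIntegral_mul b hf]
  exact circleIntegral.integral_congr hr hb

end CircleIntegral

section RieszProjection

open Metric

variable {𝒜 : Type*} [NormedRing 𝒜] [NormedAlgebra ℂ 𝒜]

/-- The Riesz projection `(2πi)⁻¹ ∮ (z - a)⁻¹ dz` of the part of the spectrum of `a` inside the
circle with centre `c` and radius `r`. -/
noncomputable def rieszProjection (a : 𝒜) (c : ℂ) (r : ℝ) : 𝒜 :=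
  (2 * Real.pi * Complex.I : ℂ)⁻¹ • ∮ z in C(c, r), resolvent a z

/-- The Cauchy transform `w ↦ (2πi)⁻¹ ∮ (z - w)⁻¹ (z - a)⁻¹ dz` of the resolvent of `a` on the
circle with centre `c` and radius `r`. Up to sign it inverts `w - a` on the complement of the Riesz
projection if `w` is inside the circle, and on its range if `w` is outside. -/
noncomputable def resolventCauchyTransform (a : 𝒜) (c : ℂ) (r : ℝ) (w : ℂ) : 𝒜 :=
  (2 * Real.pi * Complex.I : ℂ)⁻¹ • ∮ z in C(c, r), (z - w)⁻¹ • resolvent a z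

theorem commute_resolvent {a b : 𝒜} (h : Commute b a) {z : ℂ} (hz : z ∈ resolventSet ℂ a) :
    Commute b (resolvent a z) := by
  obtain ⟨u, hu⟩ := hz
  rw [resolvent, ← hu, Ring.inverse_unit]
  exact .units_inv_right (hu ▸ (Algebra.commute_algebraMap_right z b).sub_right h)

variable [CompleteSpace 𝒜] {a : 𝒜} {c w : ℂ} {r r₁ r₂ : ℝ}

theorem continuousOn_resolvent {K : Set ℂ} (hK : K ⊆ resolventSet ℂ a) :
    ContinuousOn (resolvent a) K := fun _ hz =>
  (spectrum.hasDerivAt_resolvent_const_left (hK hz)).continuousAt.continuousWithinAt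

theorem continuousOn_inv_sub_smul_resolvent (ha : sphere c r ⊆ resolventSet ℂ a)
    (hw : w ∉ sphere c r) : ContinuousOn (fun z => (z - w)⁻¹ • resolvent a z) (sphere c r) := by
  refine .smul (.inv₀ (by fun_prop) fun z hz => sub_ne_zero.2 ?_) (continuousOn_resolvent ha)
  rintro rfl
  exact hw hz

theorem commute_rieszProjection (hr : 0 ≤ r) (ha : sphere c r ⊆ resolventSet ℂ a) :
    Commute a (rieszProjection a c r) :=
  .smul_right (commute_circleIntegral hr ((continuousOn_resolvent ha).circleIntegrable hr)
    fun _ hz => commute_resolvent (.refl a) (ha hz)) _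

theorem commute_resolventCauchyTransform (hr : 0 ≤ r) (ha : sphere c r ⊆ resolventSet ℂ a)
    (hw : w ∉ sphere c r) : Commute a (resolventCauchyTransform a c r w) :=
  .smul_right (commute_circleIntegral hr
    ((continuousOn_inv_sub_smul_resolvent ha hw).circleIntegrable hr)
    fun _ hz => (commute_resolvent (.refl a) (ha hz)).smul_right _) _

theorem sub_mul_resolventCauchyTransform (hr : 0 ≤ r) (ha : sphere c r ⊆ resolventSet ℂ a)
    (hw : w ∉ sphere c r) :
    (algebraMap ℂ 𝒜 w - a) * resolventCauchyTransform a c r w =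
      ((2 * Real.pi * Complex.I : ℂ)⁻¹ * ∮ z in C(c, r), (z - w)⁻¹) • 1 -
        rieszProjection a c r := by
  have hne : ∀ z ∈ sphere c r, z - w ≠ 0 := fun z hz =>
    sub_ne_zero.2 fun h => hw (h ▸ hz)
  have hint : CircleIntegrable (fun z => (z - w)⁻¹ • (1 : 𝒜)) c r :=
    ContinuousOn.circleIntegrable hr (.smul (.inv₀ (by fun_prop) hne) continuousOn_const)
  have hresolvent : ∀ z ∈ sphere c r, (algebraMap ℂ 𝒜 w - a) * ((z - w)⁻¹ • resolvent a z) =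
      (z - w)⁻¹ • (1 : 𝒜) - resolvent a z := fun z hz => by
    have hinv : (algebraMap ℂ 𝒜 z - a) * resolvent a z = 1 := Ring.mul_inverse_cancel _ (ha hz)
    have hsub : algebraMap ℂ 𝒜 w - a = (algebraMap ℂ 𝒜 z - a) - (z - w) • 1 := by
      rw [← Algebra.algebraMap_eq_smul_one, map_sub]
      abel
    rw [mul_smul_comm, hsub, sub_mul, hinv, smul_one_mul, smul_sub, inv_smul_smul₀ (hne z hz)]
  rw [resolventCauchyTransform, rieszProjection, mul_smul_comm,
    mul_circleIntegral _ ((continuousOn_inv_sub_smul_resolvent ha hw).circleIntegrable hr),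
    circleIntegral.integral_congr hr hresolvent,
    circleIntegral.integral_sub hint ((continuousOn_resolvent ha).circleIntegrable hr),
    circleIntegral.integral_smul_const, smul_sub, smul_smul]

theorem sub_mul_resolventCauchyTransform_of_mem_ball (ha : sphere c r ⊆ resolventSet ℂ a)
    (hw : w ∈ ball c r) :
    (algebraMap ℂ 𝒜 w - a) * resolventCauchyTransform a c r w = 1 - rieszProjection a c r := by
  rw [sub_mul_resolventCauchyTransform (pos_of_mem_ball hw).le ha
    fun h => (mem_ball.1 hw).ne (mem_sphere.1 h),
    circleIntegral.integral_sub_inv_of_mem_ball hw, inv_mul_cancel₀ Complex.two_pi_I_ne_zero,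
    one_smul]

theorem sub_mul_resolventCauchyTransform_of_notMem_closedBall (hr : 0 ≤ r)
    (ha : sphere c r ⊆ resolventSet ℂ a) (hw : w ∉ closedBall c r) :
    (algebraMap ℂ 𝒜 w - a) * resolventCauchyTransform a c r w = -rieszProjection a c r := by
  have hdiff : DifferentiableOn ℂ (fun z => (z - w)⁻¹) (closedBall c r) :=
    (differentiableOn_id.sub_const w).inv fun z hz => sub_ne_zero.2 fun h => hw (h ▸ hz)
  rw [sub_mul_resolventCauchyTransform hr ha fun h => hw (sphere_subset_closedBall h),
    (hdiff.diffContOnCl_ball subset_rfl).circleIntegral_eq_zero hr, mul_zero, zero_smul, zero_sub]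

theorem rieszProjection_eq_of_annulus (h₁ : 0 < r₁) (h₁₂ : r₁ ≤ r₂)
    (ha : closedBall c r₂ \ ball c r₁ ⊆ resolventSet ℂ a) :
    rieszProjection a c r₂ = rieszProjection a c r₁ := by
  rw [rieszProjection, rieszProjection,
    Complex.circleIntegral_eq_of_differentiable_on_annulus_off_countable h₁ h₁₂
      Set.countable_empty (continuousOn_resolvent ha)]
  intro z hz
  have hz' := ha ⟨ball_subset_closedBall hz.1.1, fun h => hz.1.2 (ball_subset_closedBall h)⟩
  exact (spectrum.hasDerivAt_resolvent_const_left hz').differentiableAt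

theorem differentiableOn_resolventCauchyTransform (hr : 0 < r)
    (ha : sphere c r ⊆ resolventSet ℂ a) :
    DifferentiableOn ℂ (resolventCauchyTransform a c r) (ball c r) := by
  lift r to NNReal using hr.le
  have hseries := hasFPowerSeriesOn_cauchy_integral
    ((continuousOn_resolvent ha).circleIntegrable hr.le) hr
  rw [← Metric.eball_coe]
  exact hseries.differentiableOn

/-- Integrating `(w - a)⁻¹ (1 - P) = K(w)` over a smaller circle gives `P (1 - P) = 0`, because the
Cauchy transform `K` is holomorphic inside the larger one. -/
theorem isIdempotentElem_rieszProjection (h₁ : 0 < r₁) (h₁₂ : r₁ < r₂)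
    (ha : closedBall c r₂ \ ball c r₁ ⊆ resolventSet ℂ a) :
    IsIdempotentElem (rieszProjection a c r₁) := by
  have hs₁ := (sphere_subset_closedBall_diff_ball_left h₁₂.le).trans ha
  have hs₂ := (sphere_subset_closedBall_diff_ball_right h₁₂.le).trans ha
  have hball : closedBall c r₁ ⊆ ball c r₂ := closedBall_subset_ball h₁₂
  have hresolvent : ∀ w ∈ sphere c r₁,
      resolvent a w * (1 - rieszProjection a c r₁) = resolventCauchyTransform a c r₂ w := by
    intro w hw
    rw [← rieszProjection_eq_of_annulus h₁ h₁₂.le ha,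
      ← sub_mul_resolventCauchyTransform_of_mem_ball hs₂ (hball (sphere_subset_closedBall hw)),
      ← mul_assoc]
    exact (congrArg (· * _) (Ring.inverse_mul_cancel _ (hs₁ hw))).trans (one_mul _)
  have hzero : ∮ w in C(c, r₁), resolventCauchyTransform a c r₂ w = 0 :=
    ((differentiableOn_resolventCauchyTransform (h₁.trans h₁₂) hs₂).diffContOnCl_ball
      hball).circleIntegral_eq_zero h₁.le
  have hmul : rieszProjection a c r₁ * (1 - rieszProjection a c r₁) = 0 :=
    calc rieszProjection a c r₁ * (1 - rieszProjection a c r₁)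
      _ = (2 * Real.pi * Complex.I : ℂ)⁻¹ •
          ∮ w in C(c, r₁), resolvent a w * (1 - rieszProjection a c r₁) := by
        rw [← circleIntegral_mul _ ((continuousOn_resolvent hs₁).circleIntegrable h₁.le),
          ← smul_mul_assoc, ← rieszProjection]
      _ = 0 := by
        rw [circleIntegral.integral_congr h₁.le hresolvent, hzero, smul_zero]
  rw [mul_sub, mul_one, sub_eq_zero] at hmul
  exact hmul.symm

end RieszProjection

section ComplementarySubspaces

variable {R E : Type*} [Ring R] [AddCommGroup E] [Module R E] {M N : Submodule R E}

theorem bijective_restrict_iff_bijOn {T : E →ₗ[R] E} (hM : ∀ x ∈ M, T x ∈ M) :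
    Function.Bijective (T.restrict hM) ↔ Set.BijOn T M M :=
  ⟨fun h => ⟨hM, (Set.MapsTo.restrict_inj hM).1 h.1, (Set.MapsTo.restrict_surjective_iff hM).1 h.2⟩,
    fun h => h.bijective⟩

theorem bijective_iff_bijOn_of_isCompl {T : E →ₗ[R] E} (h : IsCompl M N)
    (hM : ∀ x ∈ M, T x ∈ M) (hN : ∀ x ∈ N, T x ∈ N) :
    Function.Bijective T ↔ Set.BijOn T M M ∧ Set.BijOn T N N := by
  let e := Submodule.prodEquivOfIsCompl M N h
  have hcomp : T ∘ e = e ∘ Prod.map (T.restrict hM) (T.restrict hN) :=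
    funext fun x => map_add T (x.1 : E) x.2
  rw [← Function.Bijective.of_comp_iff T e.bijective, hcomp,
    Function.Bijective.of_comp_iff' e.bijective, Prod.map_bijective,
    bijective_restrict_iff_bijOn, bijective_restrict_iff_bijOn]

theorem bijOn_range_of_mul_eq {T S Q : Module.End R E} (hQ : IsIdempotentElem Q)
    (hTS : T * S = Q) (hST : S * T = Q) :
    Set.BijOn T (LinearMap.range Q) (LinearMap.range Q) := by
  have hfix : ∀ x ∈ LinearMap.range Q, Q x = x := by
    rintro _ ⟨x, rfl⟩
    exact LinearMap.congr_fun hQ x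
  have hmaps : ∀ {U V : Module.End R E}, U * V = Q → V * U = Q →
      ∀ x ∈ LinearMap.range Q, U x ∈ LinearMap.range Q := by
    rintro U V hUV hVU _ ⟨x, rfl⟩
    have hcomm : U * Q = Q * U := by rw [← hVU, ← mul_assoc, hUV, hVU]
    exact ⟨U x, (LinearMap.congr_fun hcomm x).symm⟩
  refine Set.InvOn.bijOn (f' := S) ⟨fun x hx => ?_, fun x hx => ?_⟩ (hmaps hTS hST) (hmaps hST hTS)
  · exact (LinearMap.congr_fun hST x).trans (hfix x hx)
  · exact (LinearMap.congr_fun hTS x).trans (hfix x hx)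

theorem bijOn_range_of_sub_mul_eq {𝕜 X : Type*} [NontriviallyNormedField 𝕜]
    [NormedAddCommGroup X] [NormedSpace 𝕜 X] {a q k : X →L[𝕜] X} {w : 𝕜} (hq : IsIdempotentElem q)
    (hk : Commute a k) (h : (algebraMap 𝕜 (X →L[𝕜] X) w - a) * k = q) :
    Set.BijOn (a - w • 1 : X →L[𝕜] X) (LinearMap.range (q : X →ₗ[𝕜] X))
      (LinearMap.range (q : X →ₗ[𝕜] X)) := by
  have hright : (a - w • 1) * -k = q := by
    rw [← Algebra.algebraMap_eq_smul_one, mul_neg, ← neg_mul, neg_sub, h]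
  have hleft : -k * (a - w • 1) = q := by
    rw [← hright]
    exact ((hk.sub_left ((Commute.one_left k).smul_left w)).neg_right).symm
  exact bijOn_range_of_mul_eq (T := ((a - w • 1 : X →L[𝕜] X) : X →ₗ[𝕜] X))
    (S := ((-k : X →L[𝕜] X) : X →ₗ[𝕜] X)) (ContinuousLinearMap.IsIdempotentElem.toLinearMap hq)
    (congrArg ContinuousLinearMap.toLinearMap hright)
    (congrArg ContinuousLinearMap.toLinearMap hleft)

end ComplementarySubspaces

section RieszDecomposition

open Metric

variable {X : Type*} [NormedAddCommGroup X] [NormedSpace ℂ X] [CompleteSpace X] {a : X →L[ℂ] X}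
  {c w : ℂ} {r r₁ r₂ : ℝ}

theorem bijOn_ker_rieszProjection (h₁ : 0 < r₁) (h₁₂ : r₁ < r₂)
    (ha : closedBall c r₂ \ ball c r₁ ⊆ resolventSet ℂ a) (hw : w ∈ ball c r₂) :
    Set.BijOn (a - w • 1 : X →L[ℂ] X) (rieszProjection a c r₁).ker
      (rieszProjection a c r₁).ker := by
  have hp := isIdempotentElem_rieszProjection h₁ h₁₂ ha
  have hs := (sphere_subset_closedBall_diff_ball_right h₁₂.le).trans ha
  rw [LinearMap.IsIdempotentElem.ker_eq_range_one_sub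
    (ContinuousLinearMap.IsIdempotentElem.toLinearMap hp)]
  refine bijOn_range_of_sub_mul_eq hp.one_sub (commute_resolventCauchyTransform
    (h₁.trans h₁₂).le hs fun h => (mem_ball.1 hw).ne (mem_sphere.1 h)) ?_
  rw [sub_mul_resolventCauchyTransform_of_mem_ball hs hw,
    rieszProjection_eq_of_annulus h₁ h₁₂.le ha]

theorem bijOn_range_rieszProjection (hr : 0 ≤ r) (ha : sphere c r ⊆ resolventSet ℂ a)
    (hp : IsIdempotentElem (rieszProjection a c r)) (hw : w ∉ closedBall c r) :
    Set.BijOn (a - w • 1 : X →L[ℂ] X) (rieszProjection a c r).range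
      (rieszProjection a c r).range := by
  refine bijOn_range_of_sub_mul_eq hp (commute_resolventCauchyTransform hr ha
    fun h => hw (sphere_subset_closedBall h)).neg_right ?_
  rw [mul_neg, sub_mul_resolventCauchyTransform_of_notMem_closedBall hr ha hw, neg_neg]

end RieszDecomposition

namespace ClosedOp

section SpectralProjection

open Metric

variable {X : Type*} [NormedAddCommGroup X] [NormedSpace ℂ X]

theorem mem_resolventSet_part_ofLinear {a : X →L[ℂ] X} {M : Submodule ℂ X}
    (h : ∀ x : (ofLinear (a : X →ₗ[ℂ] X)).domain, (x : X) ∈ M → ofLinear (a : X →ₗ[ℂ] X) x ∈ M)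
    (z : ℂ) :
    z ∈ resolventSet (part (ofLinear (a : X →ₗ[ℂ] X)) M h) ↔
      Set.BijOn (a - z • 1 : X →L[ℂ] X) M M := by
  have hM : ∀ x ∈ M, a x ∈ M := fun x hx => h ⟨x, trivial⟩ hx
  have hMz : ∀ x ∈ M, (a - z • 1 : X →L[ℂ] X) x ∈ M := fun x hx =>
    M.sub_mem (hM x hx) (M.smul_mem z hx)
  have hpart : part (ofLinear (a : X →ₗ[ℂ] X)) M h = ofLinear ((a : X →ₗ[ℂ] X).restrict hM) :=
    eq_ofLinear_of_domain_eq_top rfl fun x => rfl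
  have hneg : z • LinearMap.id - (a : X →ₗ[ℂ] X).restrict hM =
      -((a - z • 1 : X →L[ℂ] X) : X →ₗ[ℂ] X).restrict hMz := by
    ext x
    exact (neg_sub (a x) (z • (x : X))).symm
  rw [resolventSet, Set.mem_ofPred_eq, hpart, scalarSub_ofLinear, bijective_ofLinear, hneg]
  exact ((Equiv.neg M).comp_bijective _).trans (bijective_restrict_iff_bijOn hMz)

theorem isReduction_of_commute_isIdempotentElem {a p : X →L[ℂ] X} (hp : IsIdempotentElem p)
    (h : Commute a p) :
    IsReduction (ofLinear (a : X →ₗ[ℂ] X)) (LinearMap.ker (p : X →ₗ[ℂ] X))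
      (LinearMap.range (p : X →ₗ[ℂ] X)) where
  isClosed_left := p.isClosed_ker
  isClosed_right := ContinuousLinearMap.IsIdempotentElem.isClosed_range hp
  map_left x hx := by
    have hpa : p (a x) = a (p x) := congr($h.symm.eq (x : X))
    exact hpa.trans ((congrArg a hx).trans (map_zero a))
  right_le_domain _ _ := trivial
  map_right := by
    rintro _ ⟨y, hy⟩
    have hpa : p (a y) = a (p y) := congr($h.symm.eq y)
    exact ⟨a y, hpa.trans (congrArg a hy)⟩
  isCompl := (LinearMap.IsIdempotentElem.isCompl
    (ContinuousLinearMap.IsIdempotentElem.toLinearMap hp)).symm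

theorem IsReduction.commute {a p : X →L[ℂ] X} (hp : IsIdempotentElem p)
    (h : IsReduction (ofLinear (a : X →ₗ[ℂ] X)) (LinearMap.ker (p : X →ₗ[ℂ] X))
      (LinearMap.range (p : X →ₗ[ℂ] X))) : Commute a p := by
  have hcomm := (LinearMap.IsIdempotentElem.commute_iff
    (ContinuousLinearMap.IsIdempotentElem.toLinearMap hp) (T := (a : X →ₗ[ℂ] X))).2
    ⟨fun x hx => h.map_right ⟨x, trivial⟩ hx, fun x hx => h.map_left ⟨x, trivial⟩ hx⟩
  exact ContinuousLinearMap.coe_injective hcomm.symm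

variable [CompleteSpace X]

theorem IsReduction.spectrum_eq_union {a : X →L[ℂ] X} {M N : Submodule ℂ X}
    (h : IsReduction (ofLinear (a : X →ₗ[ℂ] X)) M N) :
    spectrum ℂ a = spec (part (ofLinear (a : X →ₗ[ℂ] X)) M h.map_left) ∪
      spec (part (ofLinear (a : X →ₗ[ℂ] X)) N h.map_right) := by
  refine compl_injective (Set.ext fun z => ?_)
  simp only [spec, spectrum, Set.compl_union, compl_compl, Set.mem_inter_iff,
    mem_resolventSet_part_ofLinear, mem_resolventSet_iff_bijective_sub_smul]
  exact bijective_iff_bijOn_of_isCompl (T := ((a - z • 1 : X →L[ℂ] X) : X →ₗ[ℂ] X)) h.isCompl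
    (fun x hx => M.sub_mem (h.map_left ⟨x, trivial⟩ hx) (M.smul_mem z hx))
    fun x hx => N.sub_mem (h.map_right ⟨x, trivial⟩ hx) (N.smul_mem z hx)

end SpectralProjection

section ExistenceOfProjection

open Metric

theorem IsBoundedSpectralSet.subset_spec {E : Type*} [AddCommGroup E] [Module ℂ E]
    {A : E →ₗ.[ℂ] E} {s : Set ℂ} (hs : IsBoundedSpectralSet A s) : s ⊆ spec A := by
  intro z hz
  have hz' : (z : OnePoint ℂ) ∈ specInfty A := hs.2.1 (Set.mem_image_of_mem _ hz)
  simpa [specInfty] using hz'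

theorem IsBoundedSpectralSet.isClosed {E : Type*} [AddCommGroup E] [Module ℂ E]
    {A : E →ₗ.[ℂ] E} {s : Set ℂ} (hs : IsBoundedSpectralSet A s) (hA : IsClosed (spec A)) :
    IsClosed s := by
  let toSpecInfty : spec A → specInfty A := fun z => ⟨(z : ℂ), .inl ⟨z, z.2, rfl⟩⟩
  have hcont : Continuous toSpecInfty :=
    (OnePoint.continuous_coe.comp continuous_subtype_val).subtype_mk _
  have hpre : toSpecInfty ⁻¹' (Subtype.val ⁻¹' (((↑) : ℂ → OnePoint ℂ) '' s)) =
      Subtype.val ⁻¹' s :=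
    Set.ext fun z => OnePoint.coe_injective.mem_set_image
  have hclosed : IsClosed (Subtype.val ⁻¹' s : Set (spec A)) :=
    hpre ▸ hs.2.2.1.preimage hcont
  have himage := hA.isClosedMap_subtype_val _ hclosed
  rwa [Subtype.image_preimage_coe, Set.inter_eq_right.2 hs.subset_spec] at himage

variable {X : Type*} [NormedAddCommGroup X] [NormedSpace ℂ X]

theorem IsSpectralProjection.bijective_sub_smul {a p : X →L[ℂ] X} {s : Set ℂ}
    (hp : IsSpectralProjection (ofLinear (a : X →ₗ[ℂ] X)) s p) (h0 : (0 : ℂ) ∈ s) {ξ : ℂ}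
    (hξ : ξ ∉ s) : Function.Bijective (a - ξ • p : X →L[ℂ] X) := by
  obtain ⟨hidem, hred, hker, hrange⟩ := hp
  have hbijker : Set.BijOn (a - ξ • p : X →L[ℂ] X) (LinearMap.ker (p : X →ₗ[ℂ] X))
      (LinearMap.ker (p : X →ₗ[ℂ] X)) := by
    have h0' := not_not.1 fun h => (hker.subset h).2 h0
    refine ((mem_resolventSet_part_ofLinear _ 0).1 h0').congr fun x hx => ?_
    have hpx : p x = 0 := hx
    simp [hpx]
  have hbijrange : Set.BijOn (a - ξ • p : X →L[ℂ] X) (LinearMap.range (p : X →ₗ[ℂ] X))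
      (LinearMap.range (p : X →ₗ[ℂ] X)) := by
    have hξ' := not_not.1 fun h => hξ (hrange.subset h)
    refine ((mem_resolventSet_part_ofLinear _ ξ).1 hξ').congr fun x hx => ?_
    have hpx : p x = x := (LinearMap.IsIdempotentElem.mem_range_iff
      (ContinuousLinearMap.IsIdempotentElem.toLinearMap hidem)).1 hx
    simp [hpx]
  exact (bijective_iff_bijOn_of_isCompl (T := ((a - ξ • p : X →L[ℂ] X) : X →ₗ[ℂ] X)) hred.isCompl
    hbijker.mapsTo hbijrange.mapsTo).2 ⟨hbijker, hbijrange⟩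

variable [CompleteSpace X]

theorem isSpectralProjection_rieszProjection {a : X →L[ℂ] X} {c : ℂ} {r₁ r₂ : ℝ} (h₁ : 0 < r₁)
    (h₁₂ : r₁ < r₂) (ha : closedBall c r₂ \ ball c r₁ ⊆ _root_.resolventSet ℂ a) :
    IsSpectralProjection (ofLinear (a : X →ₗ[ℂ] X)) (spectrum ℂ a ∩ ball c r₁)
      (rieszProjection a c r₁) := by
  have hs := (sphere_subset_closedBall_diff_ball_left h₁₂.le).trans ha
  have hp := isIdempotentElem_rieszProjection h₁ h₁₂ ha
  have hred := isReduction_of_commute_isIdempotentElem hp (commute_rieszProjection h₁.le hs)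
  have hunion := hred.spectrum_eq_union
  have hker : spec (part (ofLinear (a : X →ₗ[ℂ] X)) _ hred.map_left) ⊆ (ball c r₁)ᶜ :=
    fun w hw hwr => hw <| (mem_resolventSet_part_ofLinear _ w).2 <|
      bijOn_ker_rieszProjection h₁ h₁₂ ha (ball_subset_ball h₁₂.le hwr)
  have hrange : spec (part (ofLinear (a : X →ₗ[ℂ] X)) _ hred.map_right) ⊆ ball c r₁ := by
    intro w hw
    by_contra hwr
    have hws : w ∉ sphere c r₁ := fun h => (hunion ▸ Set.subset_union_right :) hw (hs h)
    have hwc : w ∉ closedBall c r₁ := by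
      rw [← ball_union_sphere]
      exact fun h => h.elim hwr hws
    exact hw ((mem_resolventSet_part_ofLinear _ w).2
      (bijOn_range_rieszProjection h₁.le hs hp hwc))
  refine ⟨hp, hred, ?_, ?_⟩
  · rw [spec_ofLinear, hunion]
    grind
  · rw [hunion]
    grind

theorem IsSuitable.exists_isSpectralProjection {a : X →L[ℂ] X} {s : Set ℂ}
    (hs : IsSuitable (ofLinear (a : X →ₗ[ℂ] X)) s) :
    ∃ p : X →L[ℂ] X, IsSpectralProjection (ofLinear (a : X →ₗ[ℂ] X)) s p := by
  have hsub := hs.isBoundedSpectralSet.subset_spec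
  have hclosed : IsClosed s :=
    hs.isBoundedSpectralSet.isClosed (spec_ofLinear a ▸ spectrum.isClosed a)
  obtain ⟨r, -, hsr, hdisj⟩ := hs.disc
  obtain ⟨r₁, hr₁, hsr₁⟩ := exists_lt_subset_ball hclosed hsr
  obtain ⟨r₂, hr₁₂, hr₂⟩ := exists_between hr₁
  have hmem : ∀ z ∈ spectrum ℂ a, z ∈ ball 0 r → z ∈ s := by
    intro z hz hzr
    by_contra hzs
    have hz0 : z ≠ 0 := fun h => hzs (h ▸ hs.zero_mem)
    exact hdisj.subset ⟨⟨hzr, hz0⟩, (spec_ofLinear a).symm ▸ hz, hzs⟩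
  rw [spec_ofLinear] at hsub
  have hseq : s = spectrum ℂ a ∩ ball 0 r₁ := Set.Subset.antisymm (Set.subset_inter hsub hsr₁)
    fun z hz => hmem z hz.1 (ball_subset_ball hr₁.le hz.2)
  rw [hseq]
  refine ⟨_, isSpectralProjection_rieszProjection (pos_of_mem_ball (hsr₁ hs.zero_mem)) hr₁₂ ?_⟩
  intro z hz
  by_contra hzσ
  exact hz.2 (hsr₁ (hmem z hzσ (closedBall_subset_ball hr₂ hz.1)))

theorem IsSpectralProjection.exists_isRelDrazinInverse {a p : X →L[ℂ] X} {s : Set ℂ}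
    (hp : IsSpectralProjection (ofLinear (a : X →ₗ[ℂ] X)) s p) (hs : Bornology.IsBounded s)
    (h0 : (0 : ℂ) ∈ s) :
    ∃ b : X →L[ℂ] X, IsRelDrazinInverse (ofLinear (a : X →ₗ[ℂ] X)) s p b := by
  obtain ⟨ξ, hξ⟩ : ∃ ξ : ℂ, 2 * sSup (norm '' s) < ‖ξ‖ := NormedField.exists_lt_norm ℂ _
  have hξs : ξ ∉ s := fun h => by
    obtain ⟨C, hC⟩ := hs.exists_norm_le
    have hle := le_csSup ⟨C, Set.forall_mem_image.2 hC⟩ (Set.mem_image_of_mem norm h)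
    linarith [norm_nonneg ξ]
  obtain ⟨u, hu⟩ := ContinuousLinearMap.isUnit_iff_bijective.2 (hp.bijective_sub_smul h0 hξs)
  have hinv : IsBoundedInverse
      (subLinear (ofLinear (a : X →ₗ[ℂ] X)) (ξ • (p : X →ₗ[ℂ] X))) ↑u⁻¹ := by
    rw [subLinear_ofLinear]
    exact (isBoundedInverse_ofLinear_iff (a - ξ • p) _).2 (hu ▸ ⟨u.mul_inv, u.inv_mul⟩)
  exact ⟨_, hp, ξ, _, hξ, hinv, rfl⟩

end ExistenceOfProjection

end ClosedOp

section CalkinAlgebra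

variable {𝕜 X : Type*} [NontriviallyNormedField 𝕜] [NormedAddCommGroup X] [NormedSpace 𝕜 X]

theorem isCompactOperator_of_hasFiniteRange [LocallyCompactSpace 𝕜] {Y : Type*}
    [NormedAddCommGroup Y] [NormedSpace 𝕜 Y] {u : X →L[𝕜] Y}
    (hu : (u : X →ₗ[𝕜] Y).HasFiniteRange) : IsCompactOperator u := by
  have : FiniteDimensional 𝕜 u.range := Module.Finite.iff_fg.2 hu.fg_range
  have : ProperSpace u.range := FiniteDimensional.proper 𝕜 _
  exact (isCompactOperator_of_locallyCompactSpace_dom u.rangeRestrict).clm_comp u.range.subtypeL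

open LinearMap.FiniteRangeSetoid in
theorem exists_isCompactOperator_of_isFredholm [LocallyCompactSpace 𝕜] {u : X →L[𝕜] X}
    (hu : u.IsFredholm) :
    ∃ v : X →L[𝕜] X, IsCompactOperator (v * u - 1 : X →L[𝕜] X) ∧
      IsCompactOperator (u * v - 1 : X →L[𝕜] X) := by
  have : ProperSpace 𝕜 := .of_locallyCompactSpace 𝕜
  obtain ⟨v, hvu, huv⟩ := hu.exists_isQuasiInverse
  exact ⟨v, isCompactOperator_of_hasFiniteRange (equiv_iff_hasFiniteRange.1 hvu),
    isCompactOperator_of_hasFiniteRange (equiv_iff_hasFiniteRange.1 huv)⟩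

variable (𝕜 X) in
/-- The Calkin algebra of a Banach space, bounded operators modulo compact ones. Only its Banach
space structure is recorded; operators act on it through `calkinLeftMul`. -/
abbrev CalkinQuotient : Type _ := (X →L[𝕜] X) ⧸ compactOperator (RingHom.id 𝕜) X X

/-- Left multiplication of bounded operators on the Calkin algebra. It kills exactly the compact
operators, and its values lie in a Banach algebra, so that spectral theory is available there
without a normed ring structure on the quotient itself. -/
noncomputable def calkinLeftMul : (X →L[𝕜] X) →ₐ[𝕜] CalkinQuotient 𝕜 X →L[𝕜] CalkinQuotient 𝕜 X :=
  let I := compactOperator (RingHom.id 𝕜) X X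
  AlgHom.ofLinearMap
    { toFun := fun u => I.liftQL (I.mkQL ∘L ContinuousLinearMap.mul 𝕜 (X →L[𝕜] X) u) fun v hv =>
        (Submodule.Quotient.mk_eq_zero I).2 (IsCompactOperator.clm_comp hv u)
      map_add' := fun u v => by ext ⟨w⟩; exact congrArg I.mkQ (add_mul u v w)
      map_smul' := fun c u => by ext ⟨w⟩; exact congrArg I.mkQ (smul_mul_assoc c u w) }
    (by ext ⟨w⟩; exact congrArg I.mkQ (one_mul w))
    fun u v => by ext ⟨w⟩; exact congrArg I.mkQ (mul_assoc u v w)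

theorem calkinLeftMul_eq_one_of_isCompactOperator {u : X →L[𝕜] X}
    (hu : IsCompactOperator (u - 1 : X →L[𝕜] X)) : calkinLeftMul u = 1 := by
  ext ⟨v⟩
  refine (Submodule.Quotient.eq _).2 ?_
  have huv : u * v - v = (u - 1) * v := by rw [sub_mul, one_mul]
  change u * v - v ∈ _
  rw [huv]
  exact hu.comp_clm v

theorem isUnit_calkinLeftMul_of_isFredholm [LocallyCompactSpace 𝕜] {u : X →L[𝕜] X}
    (hu : u.IsFredholm) : IsUnit (calkinLeftMul u) := by
  obtain ⟨v, hvu, huv⟩ := exists_isCompactOperator_of_isFredholm hu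
  refine isUnit_iff_exists.2 ⟨calkinLeftMul v, ?_, ?_⟩
  · rw [← map_mul, calkinLeftMul_eq_one_of_isCompactOperator huv]
  · rw [← map_mul, calkinLeftMul_eq_one_of_isCompactOperator hvu]

theorem nontrivial_calkinQuotient [CompleteSpace 𝕜] (hX : ¬ FiniteDimensional 𝕜 X) :
    Nontrivial (CalkinQuotient 𝕜 X) :=
  Submodule.Quotient.nontrivial_iff.2 fun h =>
    hX (FiniteDimensional.of_isCompactOperator_id (h ▸ Submodule.mem_top :
      (1 : X →L[𝕜] X) ∈ compactOperator (RingHom.id 𝕜) X X))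

theorem exists_not_isFredholm_sub_smul {X : Type*} [NormedAddCommGroup X] [NormedSpace ℂ X]
    [CompleteSpace X] (hX : ¬ FiniteDimensional ℂ X) (u : X →L[ℂ] X) :
    ∃ z : ℂ, ¬ (u - z • 1).IsFredholm := by
  have : IsClosed (compactOperator (RingHom.id ℂ) X X : Set (X →L[ℂ] X)) :=
    isClosed_setOfPred_isCompactOperator
  have := nontrivial_calkinQuotient hX
  obtain ⟨z, hz⟩ := spectrum.nonempty (calkinLeftMul u)
  refine ⟨z, fun h => hz (spectrum.mem_resolventSet_iff.2 ?_)⟩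
  simpa [Algebra.algebraMap_eq_smul_one] using (isUnit_calkinLeftMul_of_isFredholm h).neg

end CalkinAlgebra

section Compression

variable {X : Type*} [NormedAddCommGroup X] [NormedSpace ℂ X] {a p : X →L[ℂ] X} {z : ℂ}

theorem bijective_mul_sub_smul_of_bijOn_range (hp : IsIdempotentElem p) (hap : Commute a p)
    (hz : z ≠ 0) (h : Set.BijOn (a - z • 1 : X →L[ℂ] X) p.range p.range) :
    Function.Bijective (a * p - z • 1 : X →L[ℂ] X) := by
  have hp' := ContinuousLinearMap.IsIdempotentElem.toLinearMap hp
  have hrange : Set.BijOn (a * p - z • 1 : X →L[ℂ] X) p.range p.range := by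
    refine h.congr fun x hx => ?_
    have hpx : p x = x := (LinearMap.IsIdempotentElem.mem_range_iff hp').1 hx
    simp [hpx]
  have hker : Set.BijOn (a * p - z • 1 : X →L[ℂ] X) p.ker p.ker := by
    rw [LinearMap.IsIdempotentElem.ker_eq_range_one_sub hp']
    have hcomm : Commute (a * p) (1 - p) :=
      (Commute.one_right _).sub_right (hap.mul_left (Commute.refl p))
    refine bijOn_range_of_sub_mul_eq hp.one_sub (hcomm.smul_right z⁻¹) ?_
    rw [Algebra.algebraMap_eq_smul_one, sub_mul, mul_smul_comm, mul_smul_comm, mul_assoc a,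
      hp.mul_one_sub_self, mul_zero, smul_zero, sub_zero, smul_one_mul, inv_smul_smul₀ hz]
  exact (bijective_iff_bijOn_of_isCompl (T := (a * p - z • 1 : X →L[ℂ] X).toLinearMap)
    (LinearMap.IsIdempotentElem.isCompl hp') hrange.mapsTo hker.mapsTo).2 ⟨hrange, hker⟩

theorem isFredholm_mul_sub_smul [CompleteSpace X] (hp : IsIdempotentElem p) (hap : Commute a p)
    (hz : z ≠ 0) (h : (a - z • 1).IsFredholm) : (a * p - z • 1).IsFredholm := by
  let d := a - z • 1
  -- On the null space of `p`, where `a * p - z` is `-z`, this factor is `-z⁻¹ (a - z)`.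
  let f := p - z⁻¹ • (d * (1 - p))
  have hdp : Commute d p := hap.sub_left ((Commute.one_left p).smul_left z)
  have hdq : Commute d (1 - p) := (Commute.one_right d).sub_right hdp
  have hpq : Commute p (1 - p) := (Commute.one_right p).sub_right (Commute.refl p)
  have hsplit : a * p - z • 1 = d * p - z • (1 - p) := by
    rw [sub_mul, smul_one_mul, smul_sub]
    abel
  have hfactor : f * (a * p - z • 1) = d := by
    have hpdp : p * (d * p) = d * p := by rw [← mul_assoc, ← hdp.eq, mul_assoc, hp.eq]
    have hqdp : (1 - p) * (d * p) = 0 := by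
      rw [hdp.eq, ← mul_assoc, hp.one_sub_mul_self, zero_mul]
    calc f * (a * p - z • 1) = p * (d * p) - z • (p * (1 - p)) - z⁻¹ • (d * ((1 - p) * (d * p))) +
          z⁻¹ • z • (d * ((1 - p) * (1 - p))) := by
          rw [hsplit, sub_mul, mul_sub, mul_sub, smul_mul_assoc, smul_mul_assoc, mul_smul_comm,
            mul_smul_comm, mul_assoc, mul_assoc]
          abel
      _ = d * p + d * (1 - p) := by
          rw [hpdp, hqdp, hp.mul_one_sub_self, hp.one_sub.eq, inv_smul_smul₀ hz, mul_zero,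
            smul_zero, smul_zero, sub_zero, sub_zero]
      _ = d := by rw [← mul_add, add_sub_cancel, mul_one]
  have hcomm : Commute f (a * p - z • 1) := by
    have hfd : Commute f d := hdp.symm.sub_left (((Commute.refl d).mul_left hdq.symm).smul_left _)
    have hfp : Commute f p := (Commute.refl p).sub_left ((hdp.mul_left hpq.symm).smul_left _)
    rw [hsplit]
    exact (hfd.mul_right hfp).sub_right (((Commute.one_right f).sub_right hfp).smul_right z)
  exact isFredholm_of_commute_of_isFredholm_mul hcomm (by rwa [hfactor])

end Compression

namespace ClosedOp

section DrazinInverse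

theorem IsBoundedInverse.bijective {E : Type*} [NormedAddCommGroup E] [NormedSpace ℂ E]
    {A : E →ₗ.[ℂ] E} {c : E →L[ℂ] E} (h : IsBoundedInverse A c) : Function.Bijective A :=
  ⟨fun x y hxy => Subtype.ext <| by rw [← h.2 x, ← h.2 y, hxy],
    fun y => (A.mem_graph_iff.1 (h.1 y)).imp fun _ hx => hx.2⟩

variable {X : Type*} [NormedAddCommGroup X] [NormedSpace ℂ X] {a p b : X →L[ℂ] X} {s : Set ℂ}

theorem IsSpectralProjection.commute
    (hp : IsSpectralProjection (ofLinear (a : X →ₗ[ℂ] X)) s p) : Commute a p :=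
  hp.2.choose.commute hp.1

theorem IsRelDrazinInverse.exists_inverse
    (h : IsRelDrazinInverse (ofLinear (a : X →ₗ[ℂ] X)) s p b) :
    ∃ (ξ : ℂ) (c : X →L[ℂ] X), (a - ξ • p) * c = 1 ∧ c * (a - ξ • p) = 1 ∧ b = c * (1 - p) := by
  obtain ⟨-, ξ, c, -, hc, hb⟩ := h
  rw [subLinear_ofLinear] at hc
  obtain ⟨hright, hleft⟩ := (isBoundedInverse_ofLinear_iff (a - ξ • p) c).1 hc
  exact ⟨ξ, c, hright, hleft, hb⟩

theorem IsRelDrazinInverse.mul_eq_one_sub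
    (h : IsRelDrazinInverse (ofLinear (a : X →ₗ[ℂ] X)) s p b) : a * b = 1 - p := by
  obtain ⟨ξ, c, hc, hc', rfl⟩ := h.exists_inverse
  exact mul_mul_one_sub_of_inverse_sub_smul h.1.1 h.1.commute hc hc'

theorem IsRelDrazinInverse.isCommutingOuterInverse
    (h : IsRelDrazinInverse (ofLinear (a : X →ₗ[ℂ] X)) s p b) : IsCommutingOuterInverse a b := by
  obtain ⟨ξ, c, hc, hc', rfl⟩ := h.exists_inverse
  exact isCommutingOuterInverse_of_inverse_sub_smul h.1.1 h.1.commute hc hc'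

theorem isGenDrazinRieszInverse_of_isCommutingOuterInverse (h : IsCommutingOuterInverse a b)
    (hR : IsRiesz (a * (1 - a * b))) :
    IsGenDrazinRieszInverse (ofLinear (a : X →ₗ[ℂ] X)) b where
  range_subset _ := trivial
  range_compl_subset _ := trivial
  inner x := congr($h.mul_mul_self x)
  comm x := congr($h.commute.symm.eq x)
  riesz := ⟨_, fun _ => rfl, hR⟩

variable [CompleteSpace X]

theorem essSpec_ofLinear_nonempty (hX : ¬ FiniteDimensional ℂ X) (a : X →L[ℂ] X) :
    (essSpec (ofLinear (a : X →ₗ[ℂ] X))).Nonempty :=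
  (exists_not_isFredholm_sub_smul hX a).imp fun z => (mem_essSpec_ofLinear a z).2

theorem isFredholm_of_notMem_browderSpec {z : ℂ}
    (hz : z ∉ browderSpec (ofLinear (a : X →ₗ[ℂ] X))) : (a - z • 1).IsFredholm := by
  have h := (not_not.1 hz).isFredholm
  rwa [subLinear_ofLinear_smul_id, isFredholm_ofLinear_iff] at h

theorem IsSpectralProjection.isRiesz_mul (hX : ¬ FiniteDimensional ℂ X)
    (hp : IsSpectralProjection (ofLinear (a : X →ₗ[ℂ] X)) s p)
    (hs : s \ {0} ⊆ rieszPoints (ofLinear (a : X →ₗ[ℂ] X))) : IsRiesz (a * p) := by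
  have hap := hp.commute
  obtain ⟨hidem, hred, -, hrange⟩ := hp
  refine (essSpec_ofLinear_nonempty hX (a * p)).subset_singleton_iff.1 fun z hz => ?_
  by_contra hz0
  refine (mem_essSpec_ofLinear _ z).1 hz ?_
  by_cases hzs : z ∈ s
  · exact isFredholm_mul_sub_smul hidem hap hz0
      (isFredholm_of_notMem_browderSpec (hs ⟨hzs, hz0⟩).2)
  · have hz' := not_not.1 fun h => hzs (hrange.subset h)
    exact isFredholm_of_bijective (bijective_mul_sub_smul_of_bijOn_range hidem hap hz0
      ((mem_resolventSet_part_ofLinear _ z).1 hz'))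

end DrazinInverse

end ClosedOp

theorem mainTheorem7 {X : Type*} [NormedAddCommGroup X] [NormedSpace ℂ X] [CompleteSpace X]
    (hX : ¬ FiniteDimensional ℂ X) (A : X →ₗ.[ℂ] X) (hA : ClosedOp.MemChat A)
    (h0 : (0 : ℂ) ∈ ClosedOp.isoPts (ClosedOp.browderSpec A)) :
    (∃ s : Set ℂ, ClosedOp.IsSuitable A s) ∧
    ∀ s : Set ℂ, ClosedOp.IsSuitable A s →
      (∃ P B : X →L[ℂ] X, ClosedOp.IsRelDrazinInverse A s P B) ∧
      ∀ P B : X →L[ℂ] X, ClosedOp.IsRelDrazinInverse A s P B →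
        ClosedOp.IsGenDrazinRieszInverse A B ∧
        ClosedOp.IsBoundedProd A P ∧ ClosedOp.IsBoundedProd A B ∧
        (∀ p : ℕ, ClosedOp.IsBoundedProd (ClosedOp.pow A p) (1 - ClosedOp.prodL A B)) ∧
        ∀ z : ℂ, spectralRadius ℂ (ClosedOp.prodL A P) < ‖z‖ₑ →
          ‖z‖ₑ < (spectralRadius ℂ B)⁻¹ →
          z ∈ ClosedOp.resolventSet A ∧
          ∃ S T : X →L[ℂ] X,
            HasSum (fun p : ℕ => (z ^ (p + 1))⁻¹ •
              ClosedOp.prodL (ClosedOp.pow A p) (1 - ClosedOp.prodL A B)) S ∧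
            HasSum (fun p : ℕ => z ^ p • B ^ (p + 1)) T ∧
            ClosedOp.IsBoundedInverse (ClosedOp.scalarSub z A) (S - T) := by
  obtain ⟨a, rfl⟩ := hA.exists_eq_ofLinear
  refine ⟨ClosedOp.exists_isSuitable h0, fun s hs => ⟨?_, fun P B h => ?_⟩⟩
  · obtain ⟨P, hP⟩ := hs.exists_isSpectralProjection
    exact ⟨P, hP.exists_isRelDrazinInverse hs.isBoundedSpectralSet.1 hs.zero_mem⟩
  have hB := h.isCommutingOuterInverse
  obtain rfl : P = 1 - a * B := by rw [h.mul_eq_one_sub, sub_sub_cancel]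
  refine ⟨ClosedOp.isGenDrazinRieszInverse_of_isCommutingOuterInverse hB
      (h.1.isRiesz_mul hX hs.riesz),
    ClosedOp.isBoundedProd_ofLinear _ _, ClosedOp.isBoundedProd_ofLinear _ _, fun p => ?_,
    fun z hz hz' => ?_⟩
  · rw [ClosedOp.pow_ofLinear_coe]
    exact ClosedOp.isBoundedProd_ofLinear _ _
  rw [ClosedOp.prodL_ofLinear] at hz
  obtain ⟨S, T, hS, hT, hright, hleft⟩ := hB.exists_laurent_hasSum hz hz'
  have hST : ClosedOp.IsBoundedInverse (ClosedOp.scalarSub z (ClosedOp.ofLinear ↑a)) (S - T) := by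
    rw [ClosedOp.scalarSub_ofLinear_coe, ClosedOp.isBoundedInverse_ofLinear_iff]
    exact ⟨hright, hleft⟩
  refine ⟨hST.bijective, S, T, ?_, hT, hST⟩
  simpa only [ClosedOp.pow_ofLinear_coe, ClosedOp.prodL_ofLinear] using hS
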